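/- **Setting.** Let $\mathrm{Vec}$ be the category of complex vector spaces. Let $\mathrm{Vec}^f$ be the category whose objects are pairs $(V,L)$ with $L$ a finite set and $V=(V_x)_{x\in L}$ a family of complex vector spaces; a morphism $(V,L)\to(V',L')$ is a bijection $i:L\to L'$ together with linear maps $V_x\to V'_{i(x)}$ for $x\in L$. A functor $\mathrm{Vec}^k\to\mathrm{Vec}$ is *nice* if it is a constituent (direct summand) of a possibly infinite direct sum of functors $(V_1,\dots,V_k)\mapsto V_1^{\otimes n_1}\otimes\cdots\otimes V_k^{\otimes n_k}$. A functor $F:\mathrm{Vec}^f\to\mathrm{Vec}$ is *nice* if for each $k\ge 0$ the functor $(V_1,\dots,V_k)\mapsto F((V_i)_{i},\{1,\dots,k\})$ is nice. Nice functors $\mathrm{Vec}^f\to\mathrm{Vec}$ form the category $\mathrm{Sym}(\mathcal S)$, with the tensor product $$(F\otimes G)(V,L)=\bigoplus_{L=B\amalg C}F(V|_B,B)\otimes G(V|_C,C).$$ An *algebra* $A$ in $\mathrm{Sym}(\mathcal S)$ is a commutative, associative, unital algebra for $\otimes$: it consists of a nice functor $A$, a unit element of $A(\emptyset)$, and natural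 multiplication maps $A(V,L)\otimes A(V',L')\to A(V\amalg V',L\amalg L')$ which are associative, commutative and unital. An *$A$-module* is a nice functor $M$ with natural maps $A(V,L)\otimes M(V',L')\to M(V\amalg V',L\amalg L')$ which are associative and unital. Subalgebras and submodules are subfunctors stable under these operations (subalgebras also contain the unit). An *element* of a functor $F$ is an element of $F(V,L)$ for some $(V,L)$, and its *order* is $\#L$. The algebra $A$ is *finitely generated in order $1$* if there is a finite set of elements of $A$ of order $1$ that is contained in no subalgebra of $A$ other than $A$. An $A$-module $M$ is *finitely generated* if there is a finite set of elements of $M$ that is contained in no submodule of $M$ other than $M$. A module is *noetherian* if every ascending chain of its submodules stabilizes, and $A$ is *noetherian* if every finitely generated $A$-module is noetherian. **Theorem.** Every algebra in $\mathrm{Sym}(\mathcal S)$ which is finitely generated in order $1$ is noetherian. -/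

import Mathlib

open CategoryTheory
open scoped TensorProduct DirectSum

universe u

namespace SymSchur

/-! Finite families of complex vector spaces -/

/-- A finite family of complex vector spaces: a finite set `L` and a vector space `V x` for
each `x ∈ L`. -/
structure FamVec : Type (u + 1) where
  L : Type
  [finite : Finite L]
  V : L → ModuleCat.{u} ℂ

attribute [instance] FamVec.finite

namespace FamVec

/-- A morphism `(V, L) ⟶ (V', L')`: a bijection `L ≃ L'`, together with a linear map from `V x`
to the space of `V'` at the image of `x`, for each `x ∈ L`. -/
structure Hom (X Y : FamVec.{u}) : Type u where
  equiv : X.L ≃ Y.L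
  lin : ∀ x : X.L, X.V x →ₗ[ℂ] Y.V (equiv x)

instance category : Category FamVec.{u} where
  Hom := Hom
  id X := ⟨Equiv.refl X.L, fun _ => LinearMap.id⟩
  comp f g := ⟨f.equiv.trans g.equiv, fun x => (g.lin (f.equiv x)).comp (f.lin x)⟩
  id_comp _ := rfl
  comp_id _ := rfl
  assoc _ _ _ := rfl

/-- The order of a family is the number of its members. -/
noncomputable def order (X : FamVec.{u}) : ℕ := Nat.card X.L

/-- The empty family. -/
abbrev empty : FamVec.{u} where
  L := Empty
  V := fun x => x.elim

/-- The disjoint union `(V ⨿ V', L ⨿ L')` of two families. -/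
abbrev disj (X Y : FamVec.{u}) : FamVec.{u} where
  L := X.L ⊕ Y.L
  V := Sum.elim X.V Y.V

/-- The disjoint union of two morphisms. -/
def disjMap {X X' Y Y' : FamVec.{u}} (f : X ⟶ X') (g : Y ⟶ Y') : X.disj Y ⟶ X'.disj Y' where
  equiv := Equiv.sumCongr f.equiv g.equiv
  lin := fun
    | Sum.inl x => f.lin x
    | Sum.inr y => g.lin y

/-- The canonical map `(X ⨿ Y) ⨿ Z ⟶ X ⨿ (Y ⨿ Z)`. -/
def assocHom (X Y Z : FamVec.{u}) : (X.disj Y).disj Z ⟶ X.disj (Y.disj Z) where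
  equiv := Equiv.sumAssoc X.L Y.L Z.L
  lin := fun
    | Sum.inl (Sum.inl _) => LinearMap.id
    | Sum.inl (Sum.inr _) => LinearMap.id
    | Sum.inr _ => LinearMap.id

/-- The canonical map `X ⨿ Y ⟶ Y ⨿ X`. -/
def swapHom (X Y : FamVec.{u}) : X.disj Y ⟶ Y.disj X where
  equiv := Equiv.sumComm X.L Y.L
  lin := fun
    | Sum.inl _ => LinearMap.id
    | Sum.inr _ => LinearMap.id

/-- The canonical map `∅ ⨿ X ⟶ X`. -/
def emptyDisjHom (X : FamVec.{u}) : empty.disj X ⟶ X where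
  equiv := Equiv.emptySum Empty X.L
  lin := fun
    | Sum.inl x => x.elim
    | Sum.inr _ => LinearMap.id

/-- The functor from `k`-tuples of vector spaces to families indexed by `Fin k`. -/
def ofTuple (k : ℕ) : (Fin k → ModuleCat.{u} ℂ) ⥤ FamVec.{u} where
  obj V := { L := Fin k, V := V }
  map f := ⟨Equiv.refl (Fin k), fun i => (f i).hom⟩
  map_id _ := rfl
  map_comp _ _ := rfl

end FamVec

/-! Nice functors -/

/-- The space `V₁^{⊗ n₁} ⊗ ⋯ ⊗ Vₖ^{⊗ nₖ}`. -/
abbrev TensorPow {k : ℕ} (n : Fin k → ℕ) (V : Fin k → ModuleCat.{u} ℂ) : Type u :=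
  ⨂[ℂ] p : (Σ j : Fin k, Fin (n j)), V p.1

/-- The linear map on tensor powers induced by linear maps of the factors. -/
noncomputable def tensorPowMap {k : ℕ} (n : Fin k → ℕ) {V W : Fin k → ModuleCat.{u} ℂ}
    (f : V ⟶ W) : TensorPow n V →ₗ[ℂ] TensorPow n W :=
  PiTensorProduct.map fun p => (f p.1).hom

theorem tensorPowMap_id {k : ℕ} (n : Fin k → ℕ) (V : Fin k → ModuleCat.{u} ℂ) :
    tensorPowMap n (𝟙 V) = LinearMap.id :=
  PiTensorProduct.map_id

theorem tensorPowMap_comp {k : ℕ} (n : Fin k → ℕ) {U V W : Fin k → ModuleCat.{u} ℂ}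
    (f : U ⟶ V) (g : V ⟶ W) :
    tensorPowMap n (f ≫ g) = (tensorPowMap n g).comp (tensorPowMap n f) :=
  PiTensorProduct.map_comp (fun p : (Σ j : Fin k, Fin (n j)) => (g p.1).hom)
    (fun p => (f p.1).hom)

/-- The functor `(V₁, …, Vₖ) ↦ ⨁ᵢ V₁^{⊗ n i 1} ⊗ ⋯ ⊗ Vₖ^{⊗ n i k}`, for a possibly infinite
family of exponent vectors `n i`. -/
noncomputable def tensorSum {k : ℕ} {I : Type u} (n : I → Fin k → ℕ) :
    (Fin k → ModuleCat.{u} ℂ) ⥤ ModuleCat.{u} ℂ where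
  obj V := ModuleCat.of ℂ (⨁ i : I, TensorPow (n i) V)
  map f := ModuleCat.ofHom (DirectSum.lmap fun i => tensorPowMap (n i) f)
  map_id V := by
    simp only [tensorPowMap_id, DirectSum.lmap_id, ModuleCat.ofHom_id]
  map_comp f g := by
    simp only [tensorPowMap_comp, DirectSum.lmap_comp, ModuleCat.ofHom_comp]

/-- A functor `Vec^k ⥤ Vec` is nice if it is a constituent (that is, a direct summand) of a
possibly infinite direct sum of functors `V₁^{⊗ n₁} ⊗ ⋯ ⊗ Vₖ^{⊗ nₖ}`. -/
def IsNiceMulti {k : ℕ} (F : (Fin k → ModuleCat.{u} ℂ) ⥤ ModuleCat.{u} ℂ) : Prop :=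
  ∃ (I : Type u) (n : I → Fin k → ℕ), Nonempty (Retract F (tensorSum n))

/-- A functor on finite families is nice if, for each `k`, its restriction to families of `k`
vector spaces is nice. These functors are the objects of the category `Sym(𝒮)`. -/
def IsNice (F : FamVec.{u} ⥤ ModuleCat.{u} ℂ) : Prop :=
  ∀ k : ℕ, IsNiceMulti (FamVec.ofTuple k ⋙ F)

/-! Algebras and modules -/

/-- A (commutative, associative, unital) algebra in `Sym(𝒮)`. A multiplication `A ⊗ A ⟶ A` for
`(A ⊗ A)(V, L) = ⨁_{L = B ⨿ C} A(V|B, B) ⊗ A(V|C, C)` is given as a natural family of maps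
`A(V, L) ⊗ A(V', L') → A(V ⨿ V', L ⨿ L')`, and the unit as an element of `A(∅)`. -/
structure Alg : Type (u + 1) where
  F : FamVec.{u} ⥤ ModuleCat.{u} ℂ
  nice : IsNice F
  one : F.obj FamVec.empty
  mul : ∀ X Y : FamVec.{u}, F.obj X →ₗ[ℂ] F.obj Y →ₗ[ℂ] F.obj (X.disj Y)
  mul_natural : ∀ {X X' Y Y' : FamVec.{u}} (f : X ⟶ X') (g : Y ⟶ Y') (a : F.obj X) (b : F.obj Y),
    (F.map (FamVec.disjMap f g)).hom (mul X Y a b) = mul X' Y' ((F.map f).hom a) ((F.map g).hom b)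
  mul_assoc : ∀ (X Y Z : FamVec.{u}) (a : F.obj X) (b : F.obj Y) (c : F.obj Z),
    (F.map (FamVec.assocHom X Y Z)).hom (mul (X.disj Y) Z (mul X Y a b) c) =
      mul X (Y.disj Z) a (mul Y Z b c)
  mul_comm : ∀ (X Y : FamVec.{u}) (a : F.obj X) (b : F.obj Y),
    (F.map (FamVec.swapHom X Y)).hom (mul X Y a b) = mul Y X b a
  one_mul : ∀ (X : FamVec.{u}) (a : F.obj X),
    (F.map (FamVec.emptyDisjHom X)).hom (mul FamVec.empty X one a) = a

/-- A module in `Sym(𝒮)` over the algebra `A`. -/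
structure Mod (A : Alg.{u}) : Type (u + 1) where
  F : FamVec.{u} ⥤ ModuleCat.{u} ℂ
  nice : IsNice F
  act : ∀ X Y : FamVec.{u}, A.F.obj X →ₗ[ℂ] F.obj Y →ₗ[ℂ] F.obj (X.disj Y)
  act_natural : ∀ {X X' Y Y' : FamVec.{u}} (f : X ⟶ X') (g : Y ⟶ Y')
    (a : A.F.obj X) (m : F.obj Y),
    (F.map (FamVec.disjMap f g)).hom (act X Y a m) =
      act X' Y' ((A.F.map f).hom a) ((F.map g).hom m)
  mul_act : ∀ (X Y Z : FamVec.{u}) (a : A.F.obj X) (b : A.F.obj Y) (m : F.obj Z),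
    (F.map (FamVec.assocHom X Y Z)).hom (act (X.disj Y) Z (A.mul X Y a b) m) =
      act X (Y.disj Z) a (act Y Z b m)
  one_act : ∀ (X : FamVec.{u}) (m : F.obj X),
    (F.map (FamVec.emptyDisjHom X)).hom (act FamVec.empty X A.one m) = m

/-- An element of a functor `F` on finite families is an element of `F(V, L)` for some `(V, L)`. -/
abbrev Elt (F : FamVec.{u} ⥤ ModuleCat.{u} ℂ) : Type (u + 1) :=
  Σ X : FamVec.{u}, F.obj X

/-- A subalgebra of `A`. -/
structure Subalg (A : Alg.{u}) : Type (u + 1) where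
  carrier : ∀ X : FamVec.{u}, Submodule ℂ (A.F.obj X)
  map_mem : ∀ {X Y : FamVec.{u}} (f : X ⟶ Y) (a : A.F.obj X),
    a ∈ carrier X → (A.F.map f).hom a ∈ carrier Y
  one_mem : A.one ∈ carrier FamVec.empty
  mul_mem : ∀ {X Y : FamVec.{u}} (a : A.F.obj X) (b : A.F.obj Y),
    a ∈ carrier X → b ∈ carrier Y → A.mul X Y a b ∈ carrier (X.disj Y)

/-- An `A`-submodule of `M`. -/
@[ext]
structure Submod {A : Alg.{u}} (M : Mod A) : Type (u + 1) where
  carrier : ∀ X : FamVec.{u}, Submodule ℂ (M.F.obj X)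
  map_mem : ∀ {X Y : FamVec.{u}} (f : X ⟶ Y) (m : M.F.obj X),
    m ∈ carrier X → (M.F.map f).hom m ∈ carrier Y
  act_mem : ∀ {X Y : FamVec.{u}} (a : A.F.obj X) (m : M.F.obj Y),
    m ∈ carrier Y → M.act X Y a m ∈ carrier (X.disj Y)

/-- The algebra `A` is finitely generated in order 1: there is a finite set of elements of order 1
such that the only subalgebra of `A` containing them is `A` itself. -/
def Alg.FinGenInOrderOne (A : Alg.{u}) : Prop :=
  ∃ S : Set (Elt A.F), S.Finite ∧ (∀ s ∈ S, s.1.order = 1) ∧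
    ∀ B : Subalg A, (∀ s ∈ S, s.2 ∈ B.carrier s.1) → ∀ X : FamVec.{u}, B.carrier X = ⊤

/-- The module `M` is finitely generated: there is a finite set of elements of `M` such that the
only submodule of `M` containing them is `M` itself. -/
def Mod.FinGen {A : Alg.{u}} (M : Mod A) : Prop :=
  ∃ S : Set (Elt M.F), S.Finite ∧
    ∀ N : Submod M, (∀ s ∈ S, s.2 ∈ N.carrier s.1) → ∀ X : FamVec.{u}, N.carrier X = ⊤

/-- The module `M` is noetherian: every ascending chain of submodules stabilizes. -/
def Mod.IsNoetherian {A : Alg.{u}} (M : Mod A) : Prop :=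
  ∀ N : ℕ → Submod M, (∀ (i : ℕ) (X : FamVec.{u}), (N i).carrier X ≤ (N (i + 1)).carrier X) →
    ∃ i₀ : ℕ, ∀ i : ℕ, i₀ ≤ i → N i = N i₀

/-- The algebra `A` is noetherian: every finitely generated `A`-module is noetherian. -/
def Alg.IsNoetherian (A : Alg.{u}) : Prop :=
  ∀ M : Mod A, M.FinGen → M.IsNoetherian

end SymSchur

/-! The proof bounds degrees, reduces to copies of one finite-dimensional space, and then runs a
Gröbner argument with words in place of monomials.

Every variable of a product `a · m` belongs to exactly one factor, so multiplication raises no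
degree in any single variable. A finitely generated module `M` therefore has degree at most some `D`
in each variable (`Mod.FinGen.exists_degree_bound`). In such degrees the identity of an argument
acts as a linear combination of endomorphisms of rank at most `D` (`exists_combination`), so
inclusions between subfunctors can be tested on families of copies of `U = ℂ^D`
(`le_of_le_constFam`).

Collect the values of `M` on `k` copies of `U`, for all `k`, in one total space. Since `A` is
generated in order 1, this space is spanned by the results of inserting elements of a finite list in
`A(U)` into finitely many vectors of `M` (`eq_top_of_insertMap_mem`, `finiteDimensional_span_map`).
Such a result is recorded by a word: `some c` marks an inserted element, `none` a slot of the
original vector. Multiplication inserts letters and respects the shortlex order, so the leading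
words of a submodule are closed under insertion of letters. Higman's lemma makes the subword
relation a well-quasi-order, hence chains of leading sets stabilize, and with them chains of
submodules (`exists_stable_of_insert`). -/

namespace SymSchur

/-! Initial terms with respect to a well-ordered spanning family -/

section Leading

variable {K H I : Type*} [Field K] [AddCommGroup H] [Module K H] [LinearOrder I]

/-- The indices of the leading terms of the elements of `N`, with respect to the spanning
family `v`. -/
def leadingSet (v : I → H) (N : Submodule K H) : Set I :=
  {w | v w ∈ N ⊔ Submodule.span K (v '' Set.Iio w)}

theorem leadingSet_mono (v : I → H) {N N' : Submodule K H} (h : N ≤ N') :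
    leadingSet v N ⊆ leadingSet v N' :=
  fun _ hw => sup_le_sup_right h _ hw

/-- A linear combination involves finitely many indices, and these have a largest one. The zero case
covers the empty combination. -/
theorem eq_zero_or_exists_mem_span_Iic (v : I → H) {s : Set I} {x : H}
    (hx : x ∈ Submodule.span K (v '' s)) :
    x = 0 ∨ ∃ u ∈ s, x ∈ Submodule.span K (v '' Set.Iic u) := by
  have mono : ∀ {a b : I}, a ≤ b →
      Submodule.span K (v '' Set.Iic a) ≤ Submodule.span K (v '' Set.Iic b) := fun h =>
    Submodule.span_mono (Set.image_mono (Set.Iic_subset_Iic.2 h))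
  induction hx using Submodule.span_induction with
  | mem y hy =>
    obtain ⟨u, hu, rfl⟩ := hy
    exact Or.inr ⟨u, hu, Submodule.subset_span ⟨u, le_refl u, rfl⟩⟩
  | zero => exact Or.inl rfl
  | add y z _ _ hy hz =>
    rcases hy with rfl | ⟨a, ha, hy⟩
    · simpa using hz
    rcases hz with rfl | ⟨b, hb, hz⟩
    · exact Or.inr ⟨a, ha, by simpa using hy⟩
    rcases le_total a b with h | h
    · exact Or.inr ⟨b, hb, add_mem (mono h hy) hz⟩
    · exact Or.inr ⟨a, ha, add_mem hy (mono h hz)⟩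
  | smul c y _ hy =>
    rcases hy with rfl | ⟨a, ha, hy⟩
    · exact Or.inl (smul_zero c)
    · exact Or.inr ⟨a, ha, Submodule.smul_mem _ c hy⟩

/-- Division algorithm: subtracting an element of `N` with the same leading term lowers the leading
index, which terminates by well-foundedness. The family `v` need not be independent; an index whose
vector is a combination of earlier ones lies in every leading set. -/
theorem le_of_leadingSet_subset [WellFoundedLT I] (v : I → H)
    (hv : Submodule.span K (Set.range v) = ⊤) {N N' : Submodule K H} (h : N ≤ N')
    (hl : leadingSet v N' ⊆ leadingSet v N) : N' ≤ N := by
  have key : ∀ w : I, ∀ x ∈ N', x ∈ Submodule.span K (v '' Set.Iic w) → x ∈ N := by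
    intro w
    induction w using WellFoundedLT.induction with
    | ind w ih =>
    have low : ∀ x ∈ N', x ∈ Submodule.span K (v '' Set.Iio w) → x ∈ N := by
      intro x hx hs
      rcases eq_zero_or_exists_mem_span_Iic v hs with rfl | ⟨u, hu, hs⟩
      · exact N.zero_mem
      · exact ih u hu x hx hs
    intro x hx hs
    rw [← Set.Iio_insert, Set.image_insert_eq, Submodule.mem_span_insert] at hs
    obtain ⟨c, z, hz, rfl⟩ := hs
    by_cases hc : c = 0
    · subst hc
      rw [zero_smul, zero_add] at hx ⊢
      exact low z hx hz
    have hw : w ∈ leadingSet v N' := by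
      refine Submodule.mem_sup.2 ⟨c⁻¹ • (c • v w + z), N'.smul_mem _ hx, -(c⁻¹ • z),
        neg_mem (Submodule.smul_mem _ _ hz), ?_⟩
      rw [smul_add, smul_smul, inv_mul_cancel₀ hc, one_smul, add_neg_cancel_right]
    obtain ⟨n, hn, y, hy, hny⟩ := Submodule.mem_sup.1 (hl hw)
    have e : c • v w + z = c • n + (c • y + z) := by rw [← hny, smul_add, add_assoc]
    rw [e] at hx ⊢
    refine add_mem (N.smul_mem c hn) (low _ ?_ (add_mem (Submodule.smul_mem _ c hy) hz))
    have := sub_mem hx (h (N.smul_mem c hn))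
    rwa [add_sub_cancel_left] at this
  intro x hx
  have hs : x ∈ Submodule.span K (v '' Set.univ) := by
    rw [Set.image_univ, hv]; trivial
  rcases eq_zero_or_exists_mem_span_Iic v hs with rfl | ⟨u, -, hs⟩
  · exact N.zero_mem
  · exact key u x hx hs

theorem exists_stable_of_leadingSet [WellFoundedLT I] (v : I → H)
    (hv : Submodule.span K (Set.range v) = ⊤) {R : I → I → Prop}
    (hR : WellQuasiOrdered R) (N : ℕ → Submodule K H) (hN : Monotone N)
    (hup : ∀ n i j, R i j → i ∈ leadingSet v (N n) → j ∈ leadingSet v (N n)) :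
    ∃ n₀, ∀ n, n₀ ≤ n → N n = N n₀ := by
  -- Otherwise infinitely many strict steps occur, each with a new leading index. Two of these
  -- indices are related by `R`, so upward closure puts the later one in the leading set before it
  -- was new.
  by_contra! hcon
  have step : ∀ m, ∃ n, m ≤ n ∧ ∃ w, w ∈ leadingSet v (N n) ∧ w ∉ leadingSet v (N m) := by
    intro m
    obtain ⟨n, hmn, hne⟩ := hcon m
    refine ⟨n, hmn, ?_⟩
    by_contra! hsub
    exact hne (le_antisymm (le_of_leadingSet_subset v hv (hN hmn) hsub) (hN hmn))
  choose f hf w hw hw' using step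
  let a : ℕ → ℕ := fun k => f^[k] 0
  have ha : ∀ k, a (k + 1) = f (a k) := fun k => Function.iterate_succ_apply' f k 0
  have amono : Monotone a := monotone_nat_of_le_succ fun k => by rw [ha]; exact hf _
  obtain ⟨k, l, hkl, hr⟩ := hR fun k => w (a k)
  refine hw' (a l) (hup _ _ _ hr (leadingSet_mono v (hN (amono hkl)) ?_))
  simpa [ha] using hw (a k)

end Leading

/-! Words and insertion operators -/

section Words

variable {K H C J : Type*} [Field K] [AddCommGroup H] [Module K H]

/-- The composite of the insertions prescribed by a word: its `k`-th letter, if it is `some c`,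
inserts `c` in position `i + k`. -/
def insertWord (x : ℕ → C → H →ₗ[K] H) : ℕ → List (Option C) → H →ₗ[K] H
  | _, [] => LinearMap.id
  | i, none :: w => insertWord x (i + 1) w
  | i, some c :: w => insertWord x (i + 1) w ∘ₗ x i c

theorem insert_insertWord {x : ℕ → C → H →ₗ[K] H}
    (hx : ∀ i j c c' h, i ≤ j → x i c (x j c' h) = x (j + 1) c' (x i c h))
    (w : List (Option C)) (i j : ℕ) (c : C) (h : H) (hij : i ≤ j) :
    x i c (insertWord x j w h) = insertWord x (j + 1) w (x i c h) := by
  induction w generalizing j h with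
  | nil => rfl
  | cons a w ih =>
    cases a with
    | none => exact ih (j + 1) h (by omega)
    | some c' =>
      change x i c (insertWord x (j + 1) w (x j c' h)) =
        insertWord x (j + 1 + 1) w (x (j + 1) c' (x i c h))
      rw [ih (j + 1) _ (by omega), hx i j c c' h hij]

/-- A word inserts from left to right, so after the prefix `a` the later insertions all lie at or
beyond the new position. Moving the new operator past them shifts each by one, as the extended word
prescribes. -/
theorem insert_insertWord_append {x : ℕ → C → H →ₗ[K] H}
    (hx : ∀ i j c c' h, i ≤ j → x i c (x j c' h) = x (j + 1) c' (x i c h))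
    (a b : List (Option C)) (i : ℕ) (c : C) (h : H) :
    x (i + a.length) c (insertWord x i (a ++ b) h) = insertWord x i (a ++ some c :: b) h := by
  induction a generalizing i h with
  | nil => exact insert_insertWord hx b i i c h le_rfl
  | cons l a ih =>
    rw [List.length_cons, add_comm a.length, ← add_assoc]
    cases l with
    | none => exact ih (i + 1) h
    | some c' => exact ih (i + 1) (x i c' h)

theorem insertWord_mem [DecidableEq C] {x : ℕ → C → H →ₗ[K] H} {G : ℕ → Submodule K H}
    (hG : ∀ i c k, ∀ h ∈ G k, x i c h ∈ G (k + 1)) (w : List (Option C)) (i k : ℕ) (h : H)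
    (hh : h ∈ G (k + w.count none)) : insertWord x i w h ∈ G (k + w.length) := by
  induction w generalizing i h k with
  | nil => exact hh
  | cons l w ih =>
    rw [List.length_cons, add_comm w.length, ← add_assoc]
    cases l with
    | none =>
      rw [List.count_cons_self, add_comm (List.count _ _), ← add_assoc] at hh
      exact ih (i + 1) (k + 1) h hh
    | some c =>
      rw [List.count_cons_of_ne (by simp)] at hh
      refine ih (i + 1) (k + 1) _ ?_
      rw [add_right_comm]
      exact hG _ _ _ _ hh

/-- The count condition forbids inserting `none`, so the longer word arises by inserting letters
`some c` one at a time. The prefix `a` holds the part already treated. -/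
theorem sublist_induction_insert [DecidableEq C] {P : List (Option C) → Prop}
    (hP : ∀ a b c, P (a ++ b) → P (a ++ some c :: b)) {w w' : List (Option C)}
    (h : w.Sublist w') (hc : w'.count none ≤ w.count none) (a : List (Option C))
    (hw : P (a ++ w)) : P (a ++ w') := by
  induction h generalizing a with
  | slnil => exact hw
  | @cons w w' l h ih =>
    cases l with
    | none =>
      have := h.count_le none
      rw [List.count_cons_self] at hc
      omega
    | some c =>
      rw [List.count_cons_of_ne (by simp)] at hc
      exact hP _ _ _ (ih hc a hw)
  | @cons_cons w w' l h ih =>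
    rw [List.count_cons, List.count_cons] at hc
    have := ih (by omega) (a ++ [l]) (by simpa using hw)
    simpa using this

theorem lex_append_cons {α : Type*} {r : α → α → Prop} [Std.Irrefl r] (c : α)
    (a a' b b' : List α) (ha : a.length = a'.length) (h : List.Lex r (a ++ b) (a' ++ b')) :
    List.Lex r (a ++ c :: b) (a' ++ c :: b') := by
  induction a generalizing a' with
  | nil =>
    obtain rfl : a' = [] := by simpa [eq_comm] using ha
    exact List.Lex.cons h
  | cons l a ih =>
    cases a' with
    | nil => simp at ha
    | cons l' a' =>
      cases h with
      | rel h => exact List.Lex.rel h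
      | cons h => exact List.Lex.cons (ih a' (by simpa using ha) h)

theorem shortlex_append_cons {α : Type*} {r : α → α → Prop} [Std.Irrefl r] (c : α)
    {a a' b b' : List α} (ha : a.length = a'.length)
    (h : List.Shortlex r (a ++ b) (a' ++ b')) :
    List.Shortlex r (a ++ c :: b) (a' ++ c :: b') := by
  rw [List.shortlex_def] at h ⊢
  simp only [List.length_append, List.length_cons] at h ⊢
  rcases h with h | ⟨h, h'⟩
  · left; omega
  · right; exact ⟨by omega, lex_append_cons c a a' b b' ha h'⟩

/-- Higman's lemma for equality on a finite alphabet. -/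
theorem wellQuasiOrdered_sublist (α : Type*) [Finite α] :
    WellQuasiOrdered (List.Sublist (α := α)) := by
  have h := Set.PartiallyWellOrderedOn.partiallyWellOrderedOn_sublistForall₂ (α := α) (· = ·)
    (s := Set.univ) (Set.finite_univ.partiallyWellOrderedOn)
  intro f
  obtain ⟨m, n, hmn, hr⟩ := h fun k => ⟨f k, fun _ _ => trivial⟩
  refine ⟨m, n, hmn, ?_⟩
  obtain ⟨l, h1, h2⟩ := List.sublistForall₂_iff.1 hr
  rw [List.forall₂_eq_eq_eq] at h1
  subst h1
  exact h2

/-- A chain of subspaces stable under insertion operators stabilizes, if the whole space is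
spanned by the words in finitely many generators. -/
theorem exists_stable_of_insert [DecidableEq C] [Finite C] [Finite J] {x : ℕ → C → H →ₗ[K] H}
    (hx : ∀ i j c c' h, i ≤ j → x i c (x j c' h) = x (j + 1) c' (x i c h))
    {G : ℕ → Submodule K H} (hG : ∀ i c k, ∀ h ∈ G k, x i c h ∈ G (k + 1))
    (hG' : ∀ i c k, k < i → ∀ h ∈ G k, x i c h = 0) (p : J → H) (n : J → ℕ)
    (hp : ∀ j, p j ∈ G (n j))
    (hv : Submodule.span K {h | ∃ j w, w.count none = n j ∧ h = insertWord x 0 w (p j)} = ⊤)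
    (N : ℕ → Submodule K H) (hN : Monotone N) (hNx : ∀ m i c, ∀ h ∈ N m, x i c h ∈ N m) :
    ∃ n₀, ∀ n, n₀ ≤ n → N n = N n₀ := by
  let I := {q : J × List (Option C) // q.2.count none = n q.1}
  have : IsWellOrder (List (Option C)) (List.Shortlex WellOrderingRel) :=
    { wf := List.Shortlex.wf WellOrderingRel.isWellOrder.wf }
  -- Shortlex is used because plain lexicographic order on words is not well-founded in general. An
  -- insertion does not change the generator index, so comparing that index first is harmless.
  let r₀ : J × List (Option C) → J × List (Option C) → Prop :=
    Prod.Lex WellOrderingRel (List.Shortlex WellOrderingRel)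
  let r : I → I → Prop := fun a b => r₀ a.1 b.1
  have : IsWellOrder I r :=
    { wf := InvImage.wf _ (IsWellFounded.wf (r := r₀))
      trichotomous := fun a b h1 h2 =>
        Subtype.ext (Std.Trichotomous.trichotomous (r := r₀) _ _ h1 h2) }
  let _ : LinearOrder I := IsWellOrder.linearOrder r
  have : WellFoundedLT I := ⟨IsWellFounded.wf (r := r)⟩
  let v : I → H := fun q => insertWord x 0 q.1.2 (p q.1.1)
  have hvG : ∀ q : I, v q ∈ G q.1.2.length := fun q => by
    have := insertWord_mem hG q.1.2 0 0 (p q.1.1) (by rw [q.2, zero_add]; exact hp _)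
    rwa [zero_add] at this
  have hspan : Submodule.span K (Set.range v) = ⊤ := by
    rw [← hv]
    congr 1
    ext h
    constructor
    · rintro ⟨q, rfl⟩
      exact ⟨q.1.1, q.1.2, q.2, rfl⟩
    · rintro ⟨j, w, hw, rfl⟩
      exact ⟨⟨(j, w), hw⟩, rfl⟩
  have hcount : ∀ (a b : List (Option C)) (c : C),
      (a ++ some c :: b).count none = (a ++ b).count none := fun a b c => by
    rw [List.count_append, List.count_append, List.count_cons_of_ne (by simp)]
  let R₀ : J × List (Option C) → J × List (Option C) → Prop :=
    fun a b => a.1 = b.1 ∧ a.2.Sublist b.2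
  have hR₀ : WellQuasiOrdered R₀ :=
    WellQuasiOrdered.prod (Finite.wellQuasiOrdered _) (wellQuasiOrdered_sublist _)
  refine exists_stable_of_leadingSet v hspan (R := fun a b => R₀ a.1 b.1)
    (fun f => hR₀ fun k => (f k).1) N hN ?_
  rintro m ⟨⟨j, w⟩, hw⟩ ⟨⟨j', w'⟩, hw'⟩ ⟨e, hsub⟩ hmem
  obtain rfl : j = j' := e
  refine (sublist_induction_insert
    (P := fun u => ∃ h : u.count none = n j, (⟨(j, u), h⟩ : I) ∈ leadingSet v (N m))
    ?_ hsub (le_of_eq (hw'.trans hw.symm)) [] ⟨hw, hmem⟩).2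
  rintro a b c ⟨hab, hm⟩
  have hab' : (a ++ some c :: b).count none = n j := (hcount a b c).trans hab
  refine ⟨hab', ?_⟩
  have hins : ∀ (j : J) (a b : List (Option C)) (h : (a ++ b).count none = n j),
      x a.length c (v ⟨(j, a ++ b), h⟩) = v ⟨(j, a ++ some c :: b), (hcount a b c).trans h⟩ :=
    fun j a b h => by
      have := insert_insertWord_append hx a b 0 c (p j)
      rwa [zero_add] at this
  obtain ⟨y, hy, z, hz, hyz⟩ := Submodule.mem_sup.1 hm
  change v ⟨(j, a ++ some c :: b), hab'⟩ ∈ N m ⊔ _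
  rw [← hins j a b hab, ← hyz, map_add]
  refine add_mem (Submodule.mem_sup_left (hNx _ _ _ _ hy)) (Submodule.mem_sup_right ?_)
  have hle : Submodule.span K (v '' Set.Iio ⟨(j, a ++ b), hab⟩) ≤
      (Submodule.span K (v '' Set.Iio ⟨(j, a ++ some c :: b), hab'⟩)).comap (x a.length c) := by
    refine Submodule.span_le.2 ?_
    rintro _ ⟨⟨⟨j', u⟩, hu⟩, hlt, rfl⟩
    rw [SetLike.mem_coe, Submodule.mem_comap]
    -- A smaller word may be too short to have a position `a.length`; the insertion then kills its
    -- vector. Otherwise it splits at that position and the order is preserved.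
    by_cases hlen : u.length < a.length
    · rw [hG' a.length c u.length hlen _ (hvG ⟨(j', u), hu⟩)]
      exact Submodule.zero_mem _
    · obtain ⟨a', b', rfl, ha⟩ : ∃ a' b', u = a' ++ b' ∧ a'.length = a.length :=
        ⟨u.take a.length, u.drop a.length, (List.take_append_drop _ _).symm, by simp; omega⟩
      rw [← ha, hins j' a' b' hu]
      refine Submodule.subset_span ⟨_, ?_, rfl⟩
      have hlt' : r₀ (j', a' ++ b') (j, a ++ b) := hlt
      change r₀ (j', a' ++ some c :: b') (j, a ++ some c :: b)
      rcases Prod.lex_def.1 hlt' with h | ⟨h, h'⟩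
      · exact Prod.lex_def.2 (Or.inl h)
      · exact Prod.lex_def.2 (Or.inr ⟨h, shortlex_append_cons _ ha h'⟩)
  exact hle hz

end Words

/-! Direct sums of tensor powers -/

/-- An endomorphism of a tuple of vector spaces, given by linear maps. -/
def tupleEndo {k : ℕ} {V : Fin k → ModuleCat.{u} ℂ} (q : ∀ i, V i →ₗ[ℂ] V i) : V ⟶ V :=
  fun i => ModuleCat.ofHom (q i)

/-- A linear endomorphism of one member of a tuple of vector spaces. -/
def tupleEndoAt {k : ℕ} {V : Fin k → ModuleCat.{u} ℂ} (j : Fin k) (p : V j →ₗ[ℂ] V j) : V ⟶ V :=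
  tupleEndo (Function.update (fun _ => LinearMap.id) j p)

theorem tensorPowMap_tupleEndo_tprod {k : ℕ} (n : Fin k → ℕ) {V : Fin k → ModuleCat.{u} ℂ}
    (q : ∀ i, V i →ₗ[ℂ] V i) (v : ∀ p : (Σ j : Fin k, Fin (n j)), V p.1) :
    tensorPowMap n (tupleEndo q) (PiTensorProduct.tprod ℂ v) =
      PiTensorProduct.tprod ℂ fun p => q p.1 (v p) :=
  PiTensorProduct.map_tprod _ _

theorem tensorPowMap_smul {k : ℕ} (n : Fin k → ℕ) (V : Fin k → ModuleCat.{u} ℂ) (j : Fin k)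
    (t : ℂ) : tensorPowMap n (tupleEndoAt (V := V) j (t • LinearMap.id)) =
      t ^ n j • LinearMap.id := by
  refine PiTensorProduct.ext (MultilinearMap.ext fun v => ?_)
  simp only [LinearMap.compMultilinearMap_apply, tupleEndoAt, tensorPowMap_tupleEndo_tprod]
  have h : (fun p : (Σ j : Fin k, Fin (n j)) =>
      (Function.update (fun i => (LinearMap.id : V i →ₗ[ℂ] V i)) j (t • LinearMap.id)) p.1 (v p)) =
      fun p => (if p.1 = j then t else 1) • v p := by
    funext p
    obtain ⟨i, a⟩ := p
    by_cases h : i = j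
    · subst h
      simp
    · simp [h]
  rw [h, MultilinearMap.map_smul_univ]
  refine congrArg (· • PiTensorProduct.tprod ℂ v) ?_
  rw [Fintype.prod_sigma, Finset.prod_eq_single j (fun i _ hi => by simp [hi]) (by simp)]
  simp

/-- The linear map on a direct sum of tensor powers induced by linear maps of the factors. -/
noncomputable abbrev tensorSumMap {k : ℕ} {I : Type u} (n : I → Fin k → ℕ)
    {V W : Fin k → ModuleCat.{u} ℂ} (f : V ⟶ W) :
    (⨁ i : I, TensorPow (n i) V) →ₗ[ℂ] ⨁ i : I, TensorPow (n i) W :=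
  DirectSum.lmap fun i => tensorPowMap (n i) f

theorem tensorSumMap_smul_apply {k : ℕ} {I : Type u} (n : I → Fin k → ℕ)
    (V : Fin k → ModuleCat.{u} ℂ) (j : Fin k) (t : ℂ) (x : ⨁ i : I, TensorPow (n i) V) (i : I) :
    tensorSumMap n (tupleEndoAt (V := V) j (t • LinearMap.id)) x i = t ^ n i j • x i := by
  rw [DirectSum.lmap_apply, tensorPowMap_smul]
  rfl

/-- Each linear functional turns the identity into one between complex polynomials, where the
coefficients of `t ^ N` can be compared. -/
theorem eq_zero_of_pow_smul_eq {W : Type*} [AddCommGroup W] [Module ℂ W] {N D : ℕ} (w : W)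
    (c : ℕ → W) (h : ∀ t : ℂ, t ^ N • w = ∑ l ∈ Finset.range (D + 1), t ^ l • c l) (hN : D < N) :
    w = 0 := by
  refine (Module.forall_dual_apply_eq_zero_iff ℂ w).1 fun φ => ?_
  have hp : Polynomial.monomial N (φ w) =
      ∑ l ∈ Finset.range (D + 1), Polynomial.monomial l (φ (c l)) := by
    refine Polynomial.funext fun t => ?_
    have := congrArg φ (h t)
    simp only [map_sum, map_smul, smul_eq_mul] at this
    simpa [Polynomial.eval_finsetSum, mul_comm] using this
  have := congrArg (fun q => Polynomial.coeff q N) hp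
  simp only [Polynomial.coeff_monomial, if_true, Polynomial.finsetSum_coeff] at this
  rw [this]
  refine Finset.sum_eq_zero fun l hl => if_neg ?_
  have := Finset.mem_range.1 hl
  omega

/-- In a finite partially ordered set, the sums over upper intervals can be prescribed. -/
theorem exists_sum_upper_eq_one (P : Type*) [Fintype P] [PartialOrder P] :
    ∃ c : P → ℂ, ∀ w, ∑ s, (open Classical in if w ≤ s then c s else 0) = 1 := by
  classical
  -- Möbius-type recursion downwards from the maximal elements.
  let F : (w : P) → ((s : P) → w < s → ℂ) → ℂ :=
    fun w ih => 1 - ∑ s, if h : w < s then ih s h else 0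
  let c : P → ℂ := (wellFounded_gt (α := P)).fix F
  have hc : ∀ w, c w = 1 - ∑ s, if w < s then c s else 0 := fun w => by
    have : c w = F w fun s _ => c s := (wellFounded_gt (α := P)).fix_eq F w
    simpa [F] using this
  refine ⟨c, fun w => ?_⟩
  have h : ∀ s, (if w ≤ s then c s else 0) =
      (if w = s then c s else 0) + if w < s then c s else 0 := fun s => by
    rcases eq_or_ne w s with rfl | hne
    · simp
    · simp [hne, lt_iff_le_and_ne]
  rw [Finset.sum_congr rfl fun s _ => h s, Finset.sum_add_distrib, Finset.sum_ite_eq,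
    if_pos (Finset.mem_univ w), hc w, sub_add_cancel]

/-! ### The identity as a combination of projections of bounded rank -/

section Projections

variable {V κ : Type*} [AddCommGroup V] [Module ℂ V] (b : Module.Basis κ ℂ V)

/-- The projection to the span of finitely many members of a basis. -/
noncomputable def coordProj (S : Finset κ) : V →ₗ[ℂ] V :=
  ∑ e ∈ S, (b.coord e).smulRight (b e)

theorem coordProj_basis [DecidableEq κ] (S : Finset κ) (e : κ) :
    coordProj b S (b e) = if e ∈ S then b e else 0 := by
  simp [coordProj, Finsupp.single_apply, ite_smul]

theorem rank_range_coordProj_le (S : Finset κ) :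
    Module.rank ℂ (LinearMap.range (coordProj b S)) ≤ S.card := by
  classical
  have hle : LinearMap.range (coordProj b S) ≤ Submodule.span ℂ ((S.image b : Finset V) : Set V) := by
    rintro _ ⟨v, rfl⟩
    simp only [coordProj, LinearMap.sum_apply, LinearMap.smulRight_apply]
    exact sum_mem fun e he => Submodule.smul_mem _ _
      (Submodule.subset_span (Finset.mem_coe.2 (Finset.mem_image_of_mem b he)))
  exact (Submodule.rank_mono hle).trans ((rank_span_finset_le _).trans
    (by exact_mod_cast Finset.card_image_le))

end Projections

/-- A basis tensor survives exactly when all its factors from the `j`-th space are kept; a single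
discarded factor makes it zero. -/
theorem tensorPowMap_coordProj_basis {k : ℕ} (n : Fin k → ℕ) {V : Fin k → ModuleCat.{u} ℂ}
    {κ : Fin k → Type*} (b : ∀ i, Module.Basis (κ i) ℂ (V i)) (j : Fin k) [DecidableEq (κ j)]
    (S : Finset (κ j)) (w : ∀ p : (Σ j : Fin k, Fin (n j)), κ p.1) :
    tensorPowMap n (tupleEndoAt j (coordProj (b j) S))
        (PiTensorProduct.tprod ℂ fun p => b p.1 (w p)) =
      if (Finset.univ.image fun a => w ⟨j, a⟩) ⊆ S then
        PiTensorProduct.tprod ℂ fun p => b p.1 (w p) else 0 := by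
  rw [tupleEndoAt, tensorPowMap_tupleEndo_tprod]
  split_ifs with h
  · congr 1
    funext p
    obtain ⟨i, a⟩ := p
    by_cases hi : i = j
    · subst hi
      have : w ⟨i, a⟩ ∈ S := h (Finset.mem_image_of_mem _ (Finset.mem_univ a))
      simp [coordProj_basis, this]
    · simp [hi]
  · obtain ⟨e, he, heS⟩ := Finset.not_subset.1 h
    obtain ⟨a, -, rfl⟩ := Finset.mem_image.1 he
    refine MultilinearMap.map_coord_zero _ ⟨j, a⟩ ?_
    simp [coordProj_basis, heS]

/-- A basis tensor of degree at most `D` in `V j` uses a set `W` of at most `D` basis vectors there,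
and the projection to `S` fixes it iff `W ⊆ S`. Coefficients with sum 1 over all `S ⊇ W`, for every
`W`, therefore reproduce all such tensors. -/
theorem exists_combination_tensorSum {k : ℕ} {I : Type u} (n : I → Fin k → ℕ)
    {V : Fin k → ModuleCat.{u} ℂ} (j : Fin k) (D : ℕ) (x : ⨁ i : I, TensorPow (n i) V)
    (hx : ∀ i, x i ≠ 0 → n i j ≤ D) :
    ∃ (P : Type u) (_ : Fintype P) (c : P → ℂ) (q : P → V j →ₗ[ℂ] V j),
      (∀ s, Module.rank ℂ (LinearMap.range (q s)) ≤ D) ∧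
        ∑ s, c s • tensorSumMap n (tupleEndoAt j (q s)) x = x := by
  classical
  let b := fun i => Module.Basis.ofVectorSpace ℂ (V i)
  let κ := fun i => Module.Basis.ofVectorSpaceIndex ℂ (V i)
  let P : Finset (κ j) → Type u := fun E => {S : Finset (κ j) // S ⊆ E ∧ S.card ≤ D}
  have hfin : ∀ E, Finite (P E) := fun E =>
    Finite.of_injective (β := {S // S ∈ E.powerset})
      (fun S : P E => ⟨S.1, Finset.mem_powerset.2 S.2.1⟩)
      fun S T h => Subtype.ext (congrArg (fun R : {S // S ∈ E.powerset} => R.1) h)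
  let _ : ∀ E, Fintype (P E) := fun E => Fintype.ofFinite _
  choose c hc using fun E => exists_sum_upper_eq_one (P E)
  let Q : Finset (κ j) → (⨁ i : I, TensorPow (n i) V) → ⨁ i : I, TensorPow (n i) V := fun E x =>
    ∑ s : P E, c E s • tensorSumMap n (tupleEndoAt j (coordProj (b j) s.1)) x
  have hQadd : ∀ E y z, Q E (y + z) = Q E y + Q E z := fun E y z => by
    simp only [Q, map_add, smul_add, Finset.sum_add_distrib]
  have hQsmul : ∀ E (a : ℂ) y, Q E (a • y) = a • Q E y := fun E a y => by
    simp only [Q, map_smul, Finset.smul_sum, smul_comm a]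
  -- Asking for all large `E` makes the claim additive in `x`: take the union of the two thresholds.
  suffices h : ∃ E₀, ∀ E, E₀ ⊆ E → Q E x = x by
    obtain ⟨E, hE⟩ := h
    refine ⟨P E, inferInstance, c E, fun s => coordProj (b j) s.1, fun s => ?_, hE E subset_rfl⟩
    exact (rank_range_coordProj_le _ _).trans (by exact_mod_cast s.2.2)
  have hof : ∀ i, n i j ≤ D → ∀ y : TensorPow (n i) V, ∃ E₀, ∀ E, E₀ ⊆ E →
      Q E (DirectSum.lof ℂ I _ i y) = DirectSum.lof ℂ I _ i y := by
    intro i hi y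
    have hy : y ∈ Submodule.span ℂ (Set.range
        (Basis.piTensorProduct fun p : (Σ j : Fin k, Fin (n i j)) => b p.1)) := by
      rw [Module.Basis.span_eq]; trivial
    induction hy using Submodule.span_induction with
    | zero => exact ⟨∅, fun E _ => by simp [Q]⟩
    | add y z _ _ hy hz =>
      obtain ⟨E₁, h₁⟩ := hy
      obtain ⟨E₂, h₂⟩ := hz
      refine ⟨E₁ ∪ E₂, fun E hE => ?_⟩
      rw [map_add, hQadd, h₁ E (Finset.union_subset_left hE), h₂ E (Finset.union_subset_right hE)]
    | smul a y _ hy =>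
      obtain ⟨E₁, h₁⟩ := hy
      exact ⟨E₁, fun E hE => by rw [map_smul, hQsmul, h₁ E hE]⟩
    | mem y hy =>
      obtain ⟨w, rfl⟩ := hy
      let wj : Fin (n i j) → κ j := fun a => w ⟨j, a⟩
      refine ⟨Finset.univ.image wj, fun E hE => ?_⟩
      have hW : (Finset.univ.image wj).card ≤ D :=
        Finset.card_image_le.trans (by simpa using hi)
      have h1 := hc E ⟨_, hE, hW⟩
      simp only [Q, DirectSum.lmap_lof, Basis.piTensorProduct_apply,
        tensorPowMap_coordProj_basis]
      rw [← one_smul ℂ (DirectSum.lof ℂ I _ i _), ← h1, Finset.sum_smul]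
      refine Finset.sum_congr rfl fun s _ => ?_
      by_cases hs : (Finset.univ.image wj) ⊆ s.1
      · rw [if_pos hs, if_pos (show (⟨_, hE, hW⟩ : P E) ≤ s from hs)]
      · rw [if_neg hs, if_neg (show ¬ (⟨_, hE, hW⟩ : P E) ≤ s from hs), map_zero, smul_zero,
          zero_smul]
  have hsum : x = ∑ i ∈ DFinsupp.support x, DirectSum.lof ℂ I _ i (x i) :=
    (DirectSum.sum_support_of x).symm
  rw [hsum]
  have hmem : ∀ i ∈ DFinsupp.support x, n i j ≤ D := fun i hi => hx i (DFinsupp.mem_support_iff.1 hi)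
  generalize DFinsupp.support x = T at hmem
  induction T using Finset.induction_on with
  | empty => exact ⟨∅, fun E _ => by simp [Q]⟩
  | insert i T hi ih =>
    obtain ⟨E₁, h₁⟩ := hof i (hmem i (Finset.mem_insert_self i T)) (x i)
    obtain ⟨E₂, h₂⟩ := ih fun l hl => hmem l (Finset.mem_insert_of_mem hl)
    refine ⟨E₁ ∪ E₂, fun E hE => ?_⟩
    rw [Finset.sum_insert hi, hQadd, h₁ E (Finset.union_subset_left hE),
      h₂ E (Finset.union_subset_right hE)]

/-! Morphisms of families -/

namespace FamVec

theorem hom_ext {X Y : FamVec.{u}} {e : X.L ≃ Y.L} {l l' : ∀ x : X.L, X.V x →ₗ[ℂ] Y.V (e x)}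
    (h : ∀ x, l x = l' x) : (⟨e, l⟩ : Hom X Y) = ⟨e, l'⟩ := by
  rw [funext h]

/-- Transport of vectors along an equality of indices. -/
def castLin (X : FamVec.{u}) {x x' : X.L} (h : x = x') : X.V x →ₗ[ℂ] X.V x' :=
  h ▸ LinearMap.id

theorem castLin_comp_castLin (X : FamVec.{u}) {x x' x'' : X.L} (h : x = x') (h' : x' = x'') :
    (X.castLin h').comp (X.castLin h) = X.castLin (h.trans h') := by
  subst h h'
  rfl

theorem hom_ext_castLin {X Y : FamVec.{u}} {f g : Hom X Y} (h : ∀ x, f.equiv x = g.equiv x)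
    (h' : ∀ x, (Y.castLin (h x)).comp (f.lin x) = g.lin x) : f = g := by
  obtain ⟨e, l⟩ := f
  obtain ⟨e', l'⟩ := g
  obtain rfl : e = e' := Equiv.ext h
  exact hom_ext h'

theorem exists_iso_ofTuple (X : FamVec.{u}) :
    ∃ (k : ℕ) (V : Fin k → ModuleCat.{u} ℂ), Nonempty (X ≅ (ofTuple k).obj V) := by
  obtain ⟨k, ⟨e⟩⟩ := Finite.exists_equiv_fin X.L
  refine ⟨k, fun i => X.V (e.symm i), ⟨⟨⟨e, fun x => X.castLin (e.symm_apply_apply x).symm⟩,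
    ⟨e.symm, fun i => LinearMap.id⟩, ?_, ?_⟩⟩⟩
  · exact hom_ext_castLin (fun x => e.symm_apply_apply x)
      fun x => X.castLin_comp_castLin (e.symm_apply_apply x).symm (e.symm_apply_apply x)
  · refine hom_ext_castLin (fun i => e.apply_symm_apply i) fun i => ?_
    have key : ∀ (i i' : Fin k) (h : i = i') (h' : e.symm i = e.symm i'),
        ((castLin ((ofTuple k).obj fun i => X.V (e.symm i)) h).comp (X.castLin h'.symm)) =
          LinearMap.id := by
      rintro i _ rfl _
      rfl
    exact key _ _ (e.apply_symm_apply i) (e.symm_apply_apply (e.symm i))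

/-- The endomorphism of a family given by endomorphisms of its members. -/
def endo (X : FamVec.{u}) (q : ∀ x : X.L, X.V x →ₗ[ℂ] X.V x) : X ⟶ X :=
  ⟨Equiv.refl X.L, q⟩

open Classical in
/-- The scalar `t` at `x`, and `1` elsewhere. -/
noncomputable def scalarAt {α : Type*} (x y : α) (t : ℂ) : ℂ := if y = x then t else 1

theorem scalarAt_self {α : Type*} (x : α) (t : ℂ) : scalarAt x x t = t := if_pos rfl

theorem scalarAt_of_ne {α : Type*} {x y : α} (h : y ≠ x) (t : ℂ) : scalarAt x y t = 1 := if_neg h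

theorem scalarAt_apply {α β : Type*} {f : α → β} (hf : f.Injective) (x y : α) (t : ℂ) :
    scalarAt (f x) (f y) t = scalarAt x y t := by
  by_cases h : y = x
  · rw [h, scalarAt_self, scalarAt_self]
  · rw [scalarAt_of_ne h, scalarAt_of_ne (hf.ne h)]

/-- The scaling of one member of a family. -/
noncomputable def scaleAt (X : FamVec.{u}) (x : X.L) (t : ℂ) : X ⟶ X :=
  X.endo fun y => scalarAt x y t • LinearMap.id

theorem comp_scaleAt {X Y : FamVec.{u}} (f : X ⟶ Y) (x : X.L) (t : ℂ) :
    f ≫ Y.scaleAt (f.equiv x) t = X.scaleAt x t ≫ f := by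
  refine hom_ext fun y => ?_
  change LinearMap.comp (scalarAt (f.equiv x) (f.equiv y) t • LinearMap.id) (f.lin y) =
    (f.lin y).comp (scalarAt x y t • LinearMap.id)
  rw [scalarAt_apply f.equiv.injective, LinearMap.smul_comp, LinearMap.comp_smul]
  rfl

theorem scaleAt_inl (X Y : FamVec.{u}) (x : X.L) (t : ℂ) :
    (X.disj Y).scaleAt (Sum.inl x) t = disjMap (X.scaleAt x t) (𝟙 Y) := by
  refine hom_ext_castLin (fun z => by cases z <;> rfl) fun z => LinearMap.ext fun v => ?_
  cases z with
  | inl z =>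
    change scalarAt (Sum.inl x : X.L ⊕ Y.L) (Sum.inl z) t • v =
      scalarAt x z t • v
    rw [scalarAt_apply Sum.inl_injective]
  | inr z =>
    change scalarAt (Sum.inl x : X.L ⊕ Y.L) (Sum.inr z) t • v = v
    rw [scalarAt_of_ne (by simp), one_smul]

theorem scaleAt_inr (X Y : FamVec.{u}) (y : Y.L) (t : ℂ) :
    (X.disj Y).scaleAt (Sum.inr y) t = disjMap (𝟙 X) (Y.scaleAt y t) := by
  refine hom_ext_castLin (fun z => by cases z <;> rfl) fun z => LinearMap.ext fun v => ?_
  cases z with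
  | inl z =>
    change scalarAt (Sum.inr y : X.L ⊕ Y.L) (Sum.inl z) t • v = v
    rw [scalarAt_of_ne (by simp), one_smul]
  | inr z =>
    change scalarAt (Sum.inr y : X.L ⊕ Y.L) (Sum.inr z) t • v =
      scalarAt y z t • v
    rw [scalarAt_apply Sum.inr_injective]

theorem ofTuple_map_tupleEndoAt_smul {k : ℕ} (V : Fin k → ModuleCat.{u} ℂ) (j : Fin k) (t : ℂ) :
    (ofTuple k).map (tupleEndoAt (V := V) j (t • LinearMap.id)) =
      ((ofTuple k).obj V).scaleAt j t := by
  refine hom_ext fun i => ?_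
  change Function.update (fun i => (LinearMap.id : V i →ₗ[ℂ] V i)) j (t • LinearMap.id) i =
    scalarAt j i t • (LinearMap.id : V i →ₗ[ℂ] V i)
  by_cases h : i = j
  · subst h
    simp [scalarAt_self]
  · simp [h, scalarAt_of_ne h]

end FamVec

theorem map_comp_apply (F : FamVec.{u} ⥤ ModuleCat.{u} ℂ) {X Y Z : FamVec.{u}} (f : X ⟶ Y)
    (g : Y ⟶ Z) (a : F.obj X) :
    (F.map (f ≫ g)).hom a = (F.map g).hom ((F.map f).hom a) := by
  rw [F.map_comp]; rfl

theorem map_id_apply (F : FamVec.{u} ⥤ ModuleCat.{u} ℂ) {X : FamVec.{u}} (a : F.obj X) :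
    (F.map (𝟙 X)).hom a = a := by
  rw [F.map_id]; rfl

theorem map_inv_hom_apply (F : FamVec.{u} ⥤ ModuleCat.{u} ℂ) {X Y : FamVec.{u}} (i : X ≅ Y)
    (a : F.obj X) : (F.map i.inv).hom ((F.map i.hom).hom a) = a := by
  rw [← map_comp_apply, i.hom_inv_id, map_id_apply]

/-! Degree bounds -/

/-- The element `a` has degree at most `D` in the variable `x`: scaling this variable by `t` turns
`a` into a polynomial in `t` of degree at most `D`. -/
def DegLE (F : FamVec.{u} ⥤ ModuleCat.{u} ℂ) (D : ℕ) {X : FamVec.{u}} (x : X.L)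
    (a : F.obj X) : Prop :=
  ∃ c : ℕ → F.obj X, ∀ t : ℂ,
    (F.map (X.scaleAt x t)).hom a = ∑ l ∈ Finset.range (D + 1), t ^ l • c l

namespace DegLE

variable {F : FamVec.{u} ⥤ ModuleCat.{u} ℂ} {D : ℕ} {X Y : FamVec.{u}} {x : X.L} {a b : F.obj X}

theorem mono {D' : ℕ} (h : DegLE F D x a) (hD : D ≤ D') : DegLE F D' x a := by
  obtain ⟨c, hc⟩ := h
  refine ⟨fun l => if l < D + 1 then c l else 0, fun t => ?_⟩
  rw [hc t]
  refine Finset.sum_subset_zero_on_sdiff (Finset.range_subset_range.2 (by omega))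
    (fun l hl => ?_) fun l hl => ?_
  · have := (Finset.mem_sdiff.1 hl).2
    rw [Finset.mem_range] at this
    simp only [if_neg this, smul_zero]
  · rw [Finset.mem_range] at hl
    simp only [if_pos hl]

theorem zero : DegLE F D x 0 := ⟨0, fun t => by simp⟩

theorem add (ha : DegLE F D x a) (hb : DegLE F D x b) : DegLE F D x (a + b) := by
  obtain ⟨c, hc⟩ := ha
  obtain ⟨d, hd⟩ := hb
  exact ⟨c + d, fun t => by simp [hc, hd, Finset.sum_add_distrib]⟩

theorem smul (s : ℂ) (ha : DegLE F D x a) : DegLE F D x (s • a) := by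
  obtain ⟨c, hc⟩ := ha
  exact ⟨s • c, fun t => by simp [hc, Finset.smul_sum, smul_comm s]⟩

theorem map (f : X ⟶ Y) (ha : DegLE F D x a) : DegLE F D (f.equiv x) ((F.map f).hom a) := by
  obtain ⟨c, hc⟩ := ha
  refine ⟨fun l => (F.map f).hom (c l), fun t => ?_⟩
  rw [← map_comp_apply, FamVec.comp_scaleAt, map_comp_apply, hc t]
  simp

end DegLE

/-- The elements of degree at most `D` in each variable. -/
def degSubmodule (F : FamVec.{u} ⥤ ModuleCat.{u} ℂ) (D : ℕ) (X : FamVec.{u}) :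
    Submodule ℂ (F.obj X) where
  carrier := {a | ∀ x : X.L, DegLE F D x a}
  zero_mem' _ := DegLE.zero
  add_mem' ha hb x := (ha x).add (hb x)
  smul_mem' s _ ha x := (ha x).smul s

theorem map_mem_degSubmodule {F : FamVec.{u} ⥤ ModuleCat.{u} ℂ} {D : ℕ} {X Y : FamVec.{u}}
    (f : X ⟶ Y) {a : F.obj X} (ha : a ∈ degSubmodule F D X) :
    (F.map f).hom a ∈ degSubmodule F D Y := fun y => by
  have := (ha (f.equiv.symm y)).map f
  rwa [Equiv.apply_symm_apply] at this

/-- Scaling a variable of a disjoint union scales only one of the two factors, so the degrees do not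
add up. -/
theorem product_mem_degSubmodule {F G : FamVec.{u} ⥤ ModuleCat.{u} ℂ} {D : ℕ}
    (op : ∀ X Y : FamVec.{u}, F.obj X →ₗ[ℂ] G.obj Y →ₗ[ℂ] G.obj (X.disj Y))
    (nat : ∀ {X X' Y Y' : FamVec.{u}} (f : X ⟶ X') (g : Y ⟶ Y') (a : F.obj X) (b : G.obj Y),
      (G.map (FamVec.disjMap f g)).hom (op X Y a b) =
        op X' Y' ((F.map f).hom a) ((G.map g).hom b))
    {X Y : FamVec.{u}} {a : F.obj X} {b : G.obj Y} (ha : a ∈ degSubmodule F D X)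
    (hb : b ∈ degSubmodule G D Y) : op X Y a b ∈ degSubmodule G D (X.disj Y) := by
  rintro (x | y)
  · obtain ⟨c, hc⟩ := ha x
    refine ⟨fun l => op X Y (c l) b, fun t => ?_⟩
    rw [FamVec.scaleAt_inl, nat, hc t, map_id_apply]
    simp
  · obtain ⟨c, hc⟩ := hb y
    refine ⟨fun l => op X Y a (c l), fun t => ?_⟩
    rw [FamVec.scaleAt_inr, nat, hc t, map_id_apply]
    simp

theorem exists_degree_tensorSum {k : ℕ} {I : Type u} (n : I → Fin k → ℕ)
    {V : Fin k → ModuleCat.{u} ℂ} (x : ⨁ i : I, TensorPow (n i) V) (j : Fin k) :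
    ∃ (D : ℕ) (c : ℕ → ⨁ i : I, TensorPow (n i) V), ∀ t : ℂ,
      tensorSumMap n (tupleEndoAt j (t • LinearMap.id)) x =
        ∑ l ∈ Finset.range (D + 1), t ^ l • c l := by
  classical
  refine ⟨(DFinsupp.support x).sup fun i => n i j,
    fun l => ∑ i ∈ DFinsupp.support x, if n i j = l then DirectSum.lof ℂ I _ i (x i) else 0,
    fun t => ?_⟩
  simp only [Finset.smul_sum]
  rw [Finset.sum_comm]
  have hsum : x = ∑ i ∈ DFinsupp.support x, DirectSum.lof ℂ I _ i (x i) :=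
    (DirectSum.sum_support_of x).symm
  conv_lhs => rw [hsum, map_sum]
  refine Finset.sum_congr rfl fun i hi => ?_
  have hlt : n i j < (DFinsupp.support x).sup (fun i => n i j) + 1 :=
    Nat.lt_succ_of_le (Finset.le_sup (f := fun i => n i j) hi)
  rw [DirectSum.lmap_lof, tensorPowMap_smul]
  simp only [smul_ite, smul_zero]
  rw [Finset.sum_ite_eq, if_pos (Finset.mem_range.2 hlt), LinearMap.smul_apply, map_smul]
  rfl

/-- An element of a direct sum has finitely many nonzero components, so only finitely many exponents
occur. -/
theorem IsNice.exists_mem_degSubmodule {F : FamVec.{u} ⥤ ModuleCat.{u} ℂ} (hF : IsNice F)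
    {X : FamVec.{u}} (a : F.obj X) : ∃ D, a ∈ degSubmodule F D X := by
  obtain ⟨k, V, ⟨ι⟩⟩ := X.exists_iso_ofTuple
  obtain ⟨I, n, ⟨R⟩⟩ := hF k
  let m : F.obj ((FamVec.ofTuple k).obj V) := (F.map ι.hom).hom a
  have key : ∀ j : Fin k, ∃ D, DegLE F D (X := (FamVec.ofTuple k).obj V) j m := by
    intro j
    obtain ⟨D, c, hc⟩ := exists_degree_tensorSum n ((R.i.app V).hom m) j
    refine ⟨D, fun l => (R.r.app V).hom (c l), fun t => ?_⟩
    rw [← FamVec.ofTuple_map_tupleEndoAt_smul]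
    let f : V ⟶ V := tupleEndoAt j (t • LinearMap.id)
    have h1 : (R.r.app V).hom ((R.i.app V).hom ((F.map ((FamVec.ofTuple k).map f)).hom m)) =
        (F.map ((FamVec.ofTuple k).map f)).hom m :=
      congrArg (fun g => (g.app V).hom ((F.map ((FamVec.ofTuple k).map f)).hom m)) R.retract
    have h2 : (R.i.app V).hom ((F.map ((FamVec.ofTuple k).map f)).hom m) =
        tensorSumMap n f ((R.i.app V).hom m) :=
      congrArg (fun g => g.hom m) (R.i.naturality f)
    rw [← h1, h2, hc t]
    refine (map_sum (R.r.app V).hom _ _).trans (Finset.sum_congr rfl fun l _ => ?_)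
    exact map_smul (R.r.app V).hom _ _
  obtain ⟨D, hD⟩ : ∃ D : Fin k → ℕ, ∀ j : Fin k,
      DegLE F (D j) (X := (FamVec.ofTuple k).obj V) j m := ⟨_, fun j => (key j).choose_spec⟩
  refine ⟨(Finset.univ : Finset (Fin k)).sup D, ?_⟩
  rw [← map_inv_hom_apply F ι a]
  exact map_mem_degSubmodule ι.inv fun (j : Fin k) => (hD j).mono (Finset.le_sup (Finset.mem_univ j))

theorem degSubmodule_mono (F : FamVec.{u} ⥤ ModuleCat.{u} ℂ) {D D' : ℕ} (h : D ≤ D')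
    (X : FamVec.{u}) : degSubmodule F D X ≤ degSubmodule F D' X :=
  fun _ ha x => (ha x).mono h

theorem IsNice.exists_degree_bound {F : FamVec.{u} ⥤ ModuleCat.{u} ℂ} (hF : IsNice F)
    {S : Set (Elt F)} (hS : S.Finite) : ∃ D, ∀ s ∈ S, s.2 ∈ degSubmodule F D s.1 := by
  choose D hD using fun s : Elt F => hF.exists_mem_degSubmodule s.2
  exact ⟨hS.toFinset.sup D, fun s hs =>
    degSubmodule_mono F (Finset.le_sup (hS.mem_toFinset.2 hs)) _ (hD s)⟩

theorem Alg.FinGenInOrderOne.exists_degree_bound {A : Alg.{u}} (hA : A.FinGenInOrderOne) :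
    ∃ D, ∀ X, degSubmodule A.F D X = ⊤ := by
  obtain ⟨S, hS, -, hgen⟩ := hA
  obtain ⟨D, hD⟩ := A.nice.exists_degree_bound hS
  exact ⟨D, hgen
    { carrier := degSubmodule A.F D
      map_mem := fun f _ ha => map_mem_degSubmodule f ha
      one_mem := fun x => x.elim
      mul_mem := fun _ _ ha hb => product_mem_degSubmodule A.mul A.mul_natural ha hb } hD⟩

theorem Mod.FinGen.exists_degree_bound {A : Alg.{u}} (hA : A.FinGenInOrderOne) {M : Mod A}
    (hM : M.FinGen) : ∃ D, ∀ X, degSubmodule M.F D X = ⊤ := by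
  obtain ⟨D₁, h₁⟩ := hA.exists_degree_bound
  obtain ⟨S, hS, hgen⟩ := hM
  obtain ⟨D₂, h₂⟩ := M.nice.exists_degree_bound hS
  refine ⟨max D₁ D₂, hgen
    { carrier := degSubmodule M.F (max D₁ D₂)
      map_mem := fun f _ ha => map_mem_degSubmodule f ha
      act_mem := fun {X Y} a m hm => product_mem_degSubmodule M.act M.act_natural
        (degSubmodule_mono _ (le_max_left _ _) X ?_) hm }
    fun s hs => degSubmodule_mono _ (le_max_right _ _) _ (h₂ s hs)⟩
  rw [h₁ X]
  trivial

/-! Reduction to spaces of bounded dimension -/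

theorem exists_combination {F : FamVec.{u} ⥤ ModuleCat.{u} ℂ} (hF : IsNice F) {k : ℕ}
    {V : Fin k → ModuleCat.{u} ℂ} (j : Fin k) (D : ℕ) (m : F.obj ((FamVec.ofTuple k).obj V))
    (hm : DegLE F D (X := (FamVec.ofTuple k).obj V) j m) :
    ∃ (P : Type u) (_ : Fintype P) (c : P → ℂ) (q : P → V j →ₗ[ℂ] V j),
      (∀ s, Module.rank ℂ (LinearMap.range (q s)) ≤ D) ∧
        ∑ s, c s • (F.map ((FamVec.ofTuple k).map (tupleEndoAt j (q s)))).hom m = m := by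
  obtain ⟨I, n, ⟨R⟩⟩ := hF k
  let i' : F.obj ((FamVec.ofTuple k).obj V) →ₗ[ℂ] ⨁ i : I, TensorPow (n i) V := (R.i.app V).hom
  let r' : (⨁ i : I, TensorPow (n i) V) →ₗ[ℂ] F.obj ((FamVec.ofTuple k).obj V) := (R.r.app V).hom
  have h1 : ∀ m', r' (i' m') = m' := fun m' => congrArg (fun g => (g.app V).hom m') R.retract
  have h2 : ∀ f : V ⟶ V, i' ((F.map ((FamVec.ofTuple k).map f)).hom m) =
      tensorSumMap n f (i' m) := fun f => congrArg (fun g => g.hom m) (R.i.naturality f)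
  -- The embedding into the tensor sum is natural, so the degree bound on `m` removes all components
  -- of higher degree.
  have hτ : ∀ i, i' m i ≠ 0 → n i j ≤ D := by
    obtain ⟨c, hc⟩ := hm
    intro i hi
    by_contra! hlt
    refine hi (eq_zero_of_pow_smul_eq (i' m i) (fun l => i' (c l) i) (fun t => ?_) hlt)
    have h4 := hc t
    rw [← FamVec.ofTuple_map_tupleEndoAt_smul] at h4
    rw [← tensorSumMap_smul_apply, ← h2, h4, map_sum]
    exact (map_sum (DirectSum.component ℂ I (fun i => TensorPow (n i) V) i) _ _).trans
      (Finset.sum_congr rfl fun l _ => by rw [map_smul]; rfl)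
  obtain ⟨P, hP, c, q, hq, hsum⟩ := exists_combination_tensorSum n j D (i' m) hτ
  refine ⟨P, hP, c, q, hq, ?_⟩
  have h6 := congrArg r' hsum
  rw [h1, map_sum] at h6
  refine Eq.trans (Finset.sum_congr rfl fun s _ => ?_) h6
  rw [map_smul, ← h2, h1]

theorem mem_span_endo {F : FamVec.{u} ⥤ ModuleCat.{u} ℂ} (hF : IsNice F) {k : ℕ}
    {V : Fin k → ModuleCat.{u} ℂ} (D : ℕ) (m : F.obj ((FamVec.ofTuple k).obj V))
    (hm : m ∈ degSubmodule F D ((FamVec.ofTuple k).obj V)) (T : Finset (Fin k)) :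
    m ∈ Submodule.span ℂ {m' | ∃ q : ∀ i, V i →ₗ[ℂ] V i,
      (∀ i ∈ T, Module.rank ℂ (LinearMap.range (q i)) ≤ D) ∧
        m' = (F.map ((FamVec.ofTuple k).map (tupleEndo q))).hom m} := by
  classical
  induction T using Finset.induction_on with
  | empty =>
    refine Submodule.subset_span ⟨fun _ => LinearMap.id, by simp, ?_⟩
    exact (map_id_apply F m).symm
  | insert j T hj ih =>
    refine Submodule.span_le.2 ?_ ih
    rintro _ ⟨q, hq, rfl⟩
    obtain ⟨P, hP, c, p, hp, hsum⟩ := exists_combination hF j D m (hm j)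
    -- Expanding `m` itself before applying `q` needs only its own degree bound; precomposition with
    -- `p s` changes `q` at `j` alone.
    have h1 : (F.map ((FamVec.ofTuple k).map (tupleEndo q))).hom m =
        ∑ s, c s • (F.map ((FamVec.ofTuple k).map (tupleEndo q))).hom
          ((F.map ((FamVec.ofTuple k).map (tupleEndoAt j (p s)))).hom m) := by
      conv_lhs => rw [← hsum]
      rw [map_sum]
      exact Finset.sum_congr rfl fun s _ => map_smul _ _ _
    rw [SetLike.mem_coe, h1]
    refine sum_mem fun s _ => Submodule.smul_mem _ _ (Submodule.subset_span
      ⟨fun i => (q i).comp (Function.update (fun i => (LinearMap.id : V i →ₗ[ℂ] V i)) j (p s) i),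
        fun i hi => ?_, ?_⟩)
    · by_cases h : i = j
      · subst h
        beta_reduce
        rw [Function.update_self]
        exact (LinearMap.rank_comp_le_right _ _).trans (hp s)
      · beta_reduce
        rw [Function.update_of_ne h, LinearMap.comp_id]
        exact hq i ((Finset.mem_insert.1 hi).resolve_left h)
    · rw [← map_comp_apply]
      rfl

/-- The standard space of dimension `D`. -/
noncomputable abbrev stdSpace (D : ℕ) : ModuleCat.{u} ℂ :=
  ModuleCat.of ℂ (ULift.{u} (Fin D) →₀ ℂ)

theorem exists_factor_stdSpace {D : ℕ} {V : ModuleCat.{u} ℂ} (q : V →ₗ[ℂ] V)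
    (hq : Module.rank ℂ (LinearMap.range q) ≤ D) :
    ∃ (f : V →ₗ[ℂ] stdSpace.{u} D) (g : stdSpace.{u} D →ₗ[ℂ] V), g.comp f = q := by
  obtain ⟨f, hf⟩ := (rank_le_iff_exists_linearMap (R := ℂ)
    (M := LinearMap.range q) (M₁ := ULift.{u} (Fin D) →₀ ℂ)).1 (by simpa using hq)
  obtain ⟨g, hg⟩ := f.exists_leftInverse_of_injective (LinearMap.ker_eq_bot.2 hf)
  refine ⟨f.comp q.rangeRestrict, (LinearMap.range q).subtype.comp g, ?_⟩
  ext v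
  have := LinearMap.congr_fun hg (q.rangeRestrict v)
  exact congrArg Subtype.val this

/-- The family with index set `L` all of whose members are `U`. -/
abbrev constFam (U : ModuleCat.{u} ℂ) (L : Type) [Finite L] : FamVec.{u} where
  L := L
  V := fun _ => U

/-- Subfunctors of a nice functor of bounded degree can be compared on the standard spaces of
bounded dimension. -/
theorem le_of_le_constFam {F : FamVec.{u} ⥤ ModuleCat.{u} ℂ} (hF : IsNice F) {D : ℕ}
    (hD : ∀ X, degSubmodule F D X = ⊤) (S S' : ∀ X, Submodule ℂ (F.obj X))
    (hS : ∀ {X Y : FamVec.{u}} (f : X ⟶ Y) (a : F.obj X), a ∈ S X → (F.map f).hom a ∈ S Y)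
    (hS' : ∀ {X Y : FamVec.{u}} (f : X ⟶ Y) (a : F.obj X), a ∈ S' X → (F.map f).hom a ∈ S' Y)
    (h : ∀ k, S (constFam (stdSpace D) (Fin k)) ≤ S' (constFam (stdSpace D) (Fin k)))
    (X : FamVec.{u}) : S X ≤ S' X := by
  intro a ha
  obtain ⟨k, V, ⟨ι⟩⟩ := X.exists_iso_ofTuple
  rw [← map_inv_hom_apply F ι a]
  refine hS' ι.inv _ ?_
  have hm := hS ι.hom a ha
  generalize (F.map ι.hom).hom a = m at hm
  refine Submodule.span_le.2 ?_
    (mem_span_endo hF D m (by rw [hD]; trivial) Finset.univ)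
  rintro _ ⟨q, hq, rfl⟩
  choose f g hfg using fun i => exists_factor_stdSpace (q i) (hq i (Finset.mem_univ i))
  let f' : V ⟶ fun _ : Fin k => stdSpace D := fun i => ModuleCat.ofHom (f i)
  let g' : (fun _ : Fin k => stdSpace D) ⟶ V := fun i => ModuleCat.ofHom (g i)
  -- Through this factorization, membership passes from `S` to `S'` at the standard family in the
  -- middle.
  have e : tupleEndo q = f' ≫ g' := by
    funext i
    exact congrArg ModuleCat.ofHom (hfg i).symm
  rw [SetLike.mem_coe, e, Functor.map_comp, map_comp_apply]
  exact hS' _ _ (h k (hS ((FamVec.ofTuple k).map f') _ hm))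

/-! Constant families -/

theorem castLin_constFam (U : ModuleCat.{u} ℂ) (L : Type) [Finite L] {x x' : L} (h : x = x') :
    (constFam U L).castLin h = LinearMap.id := by
  subst h
  rfl

theorem hom_constFam_ext {X : FamVec.{u}} {U : ModuleCat.{u} ℂ} {L : Type} [Finite L]
    {f g : X ⟶ constFam U L} (h : ∀ x, f.equiv x = g.equiv x)
    (h' : ∀ x, (f.lin x : X.V x →ₗ[ℂ] U) = g.lin x) : f = g :=
  FamVec.hom_ext_castLin h fun x => by
    rw [castLin_constFam]
    exact (LinearMap.id_comp _).trans (h' x)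

/-- The identification of a disjoint union of constant families with a constant family. -/
def glue (U : ModuleCat.{u} ℂ) {L₁ L₂ L : Type} [Finite L₁] [Finite L₂] [Finite L]
    (σ : L₁ ⊕ L₂ ≃ L) : (constFam U L₁).disj (constFam U L₂) ⟶ constFam U L where
  equiv := σ
  lin := fun
    | Sum.inl _ => LinearMap.id
    | Sum.inr _ => LinearMap.id

/-- The map of constant families given by a bijection. -/
def constMap (U : ModuleCat.{u} ℂ) {L L' : Type} [Finite L] [Finite L'] (σ : L ≃ L') :
    constFam U L ⟶ constFam U L' where
  equiv := σ
  lin := fun _ => LinearMap.id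

/-- The bijection that inserts a new point in position `i`. -/
def insertEquiv {k : ℕ} (i : Fin (k + 1)) : Unit ⊕ Fin k ≃ Fin (k + 1) :=
  (Equiv.sumComm Unit (Fin k)).trans
    ((Equiv.optionEquivSumPUnit (Fin k)).symm.trans (finSuccEquiv' i).symm)

theorem insertEquiv_inl {k : ℕ} (i : Fin (k + 1)) : insertEquiv i (Sum.inl ()) = i := by
  simp [insertEquiv]

theorem insertEquiv_inr {k : ℕ} (i : Fin (k + 1)) (j : Fin k) :
    insertEquiv i (Sum.inr j) = i.succAbove j := by
  simp [insertEquiv]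

/-- The inverse of `FamVec.emptyDisjHom`. -/
def emptyDisjInv (X : FamVec.{u}) : X ⟶ FamVec.empty.disj X where
  equiv := (Equiv.emptySum Empty X.L).symm
  lin := fun _ => LinearMap.id

theorem emptyDisjHom_comp_inv (X : FamVec.{u}) :
    FamVec.emptyDisjHom X ≫ emptyDisjInv X = 𝟙 _ := by
  refine FamVec.hom_ext_castLin ?_ ?_
  · rintro (x | x)
    · exact x.elim
    · rfl
  · rintro (x | x)
    · exact x.elim
    · rfl

/-- The inverse of `FamVec.assocHom`. -/
def assocInv (X Y Z : FamVec.{u}) : X.disj (Y.disj Z) ⟶ (X.disj Y).disj Z where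
  equiv := (Equiv.sumAssoc X.L Y.L Z.L).symm
  lin := fun
    | Sum.inl _ => LinearMap.id
    | Sum.inr (Sum.inl _) => LinearMap.id
    | Sum.inr (Sum.inr _) => LinearMap.id

theorem assocHom_comp_inv (X Y Z : FamVec.{u}) :
    FamVec.assocHom X Y Z ≫ assocInv X Y Z = 𝟙 _ := by
  refine FamVec.hom_ext_castLin ?_ ?_
  · rintro ((x | x) | x) <;> rfl
  · rintro ((x | x) | x) <;> rfl

/-- The value of `F` on the target may be infinite-dimensional, but `a` meets only finitely many
tensor types, each with a finite-dimensional value on copies of `U`. The choice of bijection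
contributes a finite sum. -/
theorem finiteDimensional_span_map {F : FamVec.{u} ⥤ ModuleCat.{u} ℂ} (hF : IsNice F)
    {X : FamVec.{u}} (a : F.obj X) (U : ModuleCat.{u} ℂ) [FiniteDimensional ℂ U] (L : Type)
    [Finite L] : FiniteDimensional ℂ
      (Submodule.span ℂ (Set.range fun f : X ⟶ constFam U L => (F.map f).hom a)) := by
  classical
  obtain ⟨k, V, ⟨ι⟩⟩ := X.exists_iso_ofTuple
  obtain ⟨I, n, ⟨R⟩⟩ := hF k
  let m : F.obj ((FamVec.ofTuple k).obj V) := (F.map ι.hom).hom a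
  let τ : ⨁ i : I, TensorPow (n i) V := (R.i.app V).hom m
  let U' : Fin k → ModuleCat.{u} ℂ := fun _ => U
  let r' : (⨁ i : I, TensorPow (n i) U') →ₗ[ℂ] F.obj (constFam U (Fin k)) := (R.r.app U').hom
  have hfin : ∀ i, FiniteDimensional ℂ (TensorPow (n i) U') := fun i =>
    Module.Finite.of_basis (Basis.piTensorProduct fun _ => Module.finBasis ℂ U)
  let W : Submodule ℂ (⨁ i : I, TensorPow (n i) U') :=
    ⨆ i : {i // i ∈ DFinsupp.support τ}, LinearMap.range (DirectSum.lof ℂ I _ i.1)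
  have hW : FiniteDimensional ℂ W := Submodule.finiteDimensional_iSup _
  let Z : Submodule ℂ (F.obj (constFam U L)) :=
    ⨆ σ : Fin k ≃ L, (W.map r').map (F.map (constMap U σ)).hom
  have hZ : FiniteDimensional ℂ Z := Submodule.finiteDimensional_iSup _
  refine Submodule.finiteDimensional_of_le (S₂ := Z) (Submodule.span_le.2 ?_)
  rintro _ ⟨f, rfl⟩
  let f' : V ⟶ U' := fun i => ModuleCat.ofHom ((ι.inv ≫ f).lin i)
  have e : f = ι.hom ≫ (FamVec.ofTuple k).map f' ≫ constMap U (ι.inv ≫ f).equiv := by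
    rw [← Iso.inv_comp_eq]
    exact hom_constFam_ext (fun x => rfl) fun x => rfl
  have h1 : (F.map f).hom a = (F.map (constMap U (ι.inv ≫ f).equiv)).hom
      ((F.map ((FamVec.ofTuple k).map f')).hom m) := by
    conv_lhs => rw [e]
    rw [map_comp_apply]
    exact map_comp_apply F ((FamVec.ofTuple k).map f') (constMap U (ι.inv ≫ f).equiv) m
  have h2 : (F.map ((FamVec.ofTuple k).map f')).hom m = r' (tensorSumMap n f' τ) := by
    have h3 : (R.i.app U').hom ((F.map ((FamVec.ofTuple k).map f')).hom m) =
      tensorSumMap n f' τ := congrArg (fun g => g.hom m) (R.i.naturality f')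
    rw [← h3]
    exact (congrArg (fun g => (g.app U').hom ((F.map ((FamVec.ofTuple k).map f')).hom m))
      R.retract).symm
  have h4 : tensorSumMap n f' τ ∈ W := by
    have hsum : τ = ∑ i ∈ DFinsupp.support τ, DirectSum.lof ℂ I _ i (τ i) :=
      (DirectSum.sum_support_of τ).symm
    have hsum' : tensorSumMap n f' τ = ∑ i ∈ DFinsupp.support τ,
        tensorSumMap n f' (DirectSum.lof ℂ I _ i (τ i)) := by
      conv_lhs => rw [hsum, map_sum]
    rw [hsum']
    refine sum_mem fun i hi => ?_
    rw [DirectSum.lmap_lof]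
    exact Submodule.mem_iSup_of_mem (p := fun i : {i // i ∈ DFinsupp.support τ} =>
      LinearMap.range (DirectSum.lof ℂ I (fun i => TensorPow (n i) U') i.1)) ⟨i, hi⟩ ⟨_, rfl⟩
  change (F.map f).hom a ∈ Z
  rw [h1, h2]
  exact Submodule.mem_iSup_of_mem (p := fun σ : Fin k ≃ L =>
    (W.map r').map (F.map (constMap U σ)).hom) (ι.inv ≫ f).equiv ⟨_, ⟨_, h4, rfl⟩, rfl⟩

/-! Insertion operators on a module -/

section Insertion

variable {A : Alg.{u}} (M : Mod A) (U : ModuleCat.{u} ℂ)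

/-- Multiplication by an element of order 1, placed in position `i`. -/
noncomputable def insertMap {k : ℕ} (i : Fin (k + 1)) (a : A.F.obj (constFam U Unit)) :
    M.F.obj (constFam U (Fin k)) →ₗ[ℂ] M.F.obj (constFam U (Fin (k + 1))) :=
  (M.F.map (glue U (insertEquiv i))).hom ∘ₗ M.act _ _ a

/-- By associativity both sides come from acting with a product of `a` and `b`. Commutativity
reduces the claim to an equality of bijections, a cosimplicial identity for `Fin.succAbove`. -/
theorem insertMap_insertMap {k : ℕ} (i : Fin (k + 1)) (j : Fin (k + 1)) (hij : i ≤ j)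
    (a b : A.F.obj (constFam U Unit)) (h : M.F.obj (constFam U (Fin k))) :
    insertMap M U i.castSucc a (insertMap M U j b h) =
      insertMap M U j.succ b (insertMap M U i a h) := by
  have key : ∀ (i' : Fin (k + 2)) (j' : Fin (k + 1)) (a b : A.F.obj (constFam U Unit)),
      insertMap M U i' a (insertMap M U j' b h) =
        (M.F.map (FamVec.assocHom _ _ _ ≫ FamVec.disjMap (𝟙 _) (glue U (insertEquiv j')) ≫
          glue U (insertEquiv i'))).hom (M.act _ _ (A.mul _ _ a b) h) := by
    intro i' j' a b
    rw [map_comp_apply, map_comp_apply, M.mul_act, M.act_natural, map_id_apply]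
    rfl
  have hswap : M.act _ _ (A.mul _ _ a b) h =
      (M.F.map (FamVec.disjMap (FamVec.swapHom _ _) (𝟙 _))).hom
        (M.act _ _ (A.mul _ _ b a) h) := by
    rw [M.act_natural, A.mul_comm, map_id_apply]
  rw [key, key, hswap, ← map_comp_apply]
  congr 3
  refine hom_constFam_ext ?_ ?_
  · rintro ((x | x) | x)
    · change insertEquiv i.castSucc (Sum.inr (insertEquiv j (Sum.inl ()))) =
        insertEquiv j.succ (Sum.inl ())
      rw [insertEquiv_inl, insertEquiv_inl, insertEquiv_inr]
      exact Fin.succAbove_of_le_castSucc _ _ (by simpa using hij)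
    · change insertEquiv i.castSucc (Sum.inl ()) =
        insertEquiv j.succ (Sum.inr (insertEquiv i (Sum.inl ())))
      rw [insertEquiv_inl, insertEquiv_inl, insertEquiv_inr]
      exact (Fin.succAbove_of_castSucc_lt _ _ (by simpa [Fin.lt_def] using Nat.lt_succ_of_le hij)).symm
    · change insertEquiv i.castSucc (Sum.inr (insertEquiv j (Sum.inr x))) =
        insertEquiv j.succ (Sum.inr (insertEquiv i (Sum.inr x)))
      simp only [insertEquiv_inr]
      ext
      have : i.1 ≤ j.1 := hij
      simp only [Fin.succAbove, Fin.lt_def]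
      split_ifs <;> simp at * <;> omega
  · rintro ((x | x) | x) <;> rfl

/-- The unique point of `X` goes to some position `i`, and `Y` fills the complement of `i`. This is
where generation in order 1 turns multiplication into insertion. -/
theorem exists_insert_factor {X Y : FamVec.{u}} (hX : X.order = 1) {k : ℕ}
    (f : X.disj Y ⟶ constFam U (Fin k)) :
    ∃ (k' : ℕ) (e : k' + 1 = k) (i : Fin (k' + 1)) (f₁ : X ⟶ constFam U Unit)
      (f₂ : Y ⟶ constFam U (Fin k')), f = FamVec.disjMap f₁ f₂ ≫
        glue U ((insertEquiv i).trans (finCongr e)) := by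
  obtain ⟨hsub, ⟨x₀⟩⟩ := Nat.card_eq_one_iff_unique.1 hX
  cases k with
  | zero => exact (f.equiv (Sum.inl x₀)).elim0
  | succ k' =>
    let i : Fin (k' + 1) := f.equiv (Sum.inl x₀)
    have hne : ∀ y : Y.L, f.equiv (Sum.inr y) ≠ i := fun y h => by
      simpa using f.equiv.injective h
    choose g hg using fun y : Y.L => Fin.exists_succAbove_eq (hne y)
    have hbij : g.Bijective := by
      constructor
      · intro y y' h
        have h' : f.equiv (Sum.inr y) = f.equiv (Sum.inr y') := by rw [← hg, ← hg, h]
        simpa using f.equiv.injective h'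
      · intro z
        obtain ⟨x | y, hw⟩ := f.equiv.surjective (i.succAbove z)
        · rw [Subsingleton.elim x x₀] at hw
          exact absurd hw.symm (Fin.succAbove_ne i z)
        · refine ⟨y, Fin.succAbove_right_injective (p := i) ?_⟩
          rw [hg, hw]
    let eX : X.L ≃ Unit := ⟨fun _ => (), fun _ => x₀, fun _ => Subsingleton.elim _ _, fun _ => rfl⟩
    refine ⟨k', rfl, i, ⟨eX, fun x => f.lin (Sum.inl x)⟩,
      ⟨Equiv.ofBijective g hbij, fun y => f.lin (Sum.inr y)⟩, hom_constFam_ext ?_ ?_⟩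
    · rintro (x | y)
      · change f.equiv (Sum.inl x) = insertEquiv i (Sum.inl ())
        rw [insertEquiv_inl, Subsingleton.elim x x₀]
      · change f.equiv (Sum.inr y) = insertEquiv i (Sum.inr (g y))
        rw [insertEquiv_inr, hg]
    · rintro (x | y) <;> rfl

/-- The direct sum of the values of a module on the families of `k` copies of `U`, for all `k`. -/
abbrev TotalSpace : Type u := ⨁ k : ℕ, M.F.obj (constFam U (Fin k))

/-- The inclusion of a summand in the total space. -/
noncomputable abbrev toTotal (k : ℕ) : M.F.obj (constFam U (Fin k)) →ₗ[ℂ] TotalSpace M U :=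
  DirectSum.lof ℂ ℕ (fun k => M.F.obj (constFam U (Fin k))) k

/-- The total space is spanned by the generators of `M` under insertion of the generators
of `A`. -/
theorem eq_top_of_insertMap_mem {S : Set (Elt A.F)} (hS : ∀ s ∈ S, s.1.order = 1)
    (hA : ∀ B : Subalg A, (∀ s ∈ S, s.2 ∈ B.carrier s.1) → ∀ X : FamVec.{u}, B.carrier X = ⊤)
    {S' : Set (Elt M.F)}
    (hM : ∀ N : Submod M, (∀ s ∈ S', s.2 ∈ N.carrier s.1) → ∀ X : FamVec.{u}, N.carrier X = ⊤)
    (T : Submodule ℂ (TotalSpace M U))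
    (hT : ∀ s ∈ S, ∀ (f : s.1 ⟶ constFam U Unit) (k : ℕ) (i : Fin (k + 1))
      (h : M.F.obj (constFam U (Fin k))), toTotal M U k h ∈ T →
        toTotal M U (k + 1) (insertMap M U i ((A.F.map f).hom s.2) h) ∈ T)
    (hT' : ∀ s ∈ S', ∀ (k : ℕ) (f : s.1 ⟶ constFam U (Fin k)),
      toTotal M U k ((M.F.map f).hom s.2) ∈ T) : T = ⊤ := by
  -- The largest subfunctor of `M` whose values on copies of `U` land in `T`.
  let N : ∀ X : FamVec.{u}, Submodule ℂ (M.F.obj X) := fun X =>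
    ⨅ (k : ℕ) (f : X ⟶ constFam U (Fin k)), T.comap (toTotal M U k ∘ₗ (M.F.map f).hom)
  have hN : ∀ {X : FamVec.{u}} (m : M.F.obj X), m ∈ N X ↔
      ∀ (k : ℕ) (f : X ⟶ constFam U (Fin k)), toTotal M U k ((M.F.map f).hom m) ∈ T := by
    intro X m
    simp [N]
  have hNmap : ∀ {X Y : FamVec.{u}} (f : X ⟶ Y) (m : M.F.obj X), m ∈ N X →
      (M.F.map f).hom m ∈ N Y := by
    intro X Y f m hm
    rw [hN] at hm ⊢
    intro k g
    rw [← map_comp_apply]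
    exact hm k _
  -- The elements of `A` that preserve `N`. They form a subalgebra containing the generators, hence
  -- all of `A`, so `N` is a submodule.
  let B : ∀ X : FamVec.{u}, Submodule ℂ (A.F.obj X) := fun X =>
    ⨅ (Y : FamVec.{u}) (m : N Y), (N (X.disj Y)).comap ((M.act X Y).flip m.1)
  have hB : ∀ {X : FamVec.{u}} (a : A.F.obj X), a ∈ B X ↔
      ∀ (Y : FamVec.{u}) (m : M.F.obj Y), m ∈ N Y → M.act X Y a m ∈ N (X.disj Y) := by
    intro X a
    simp [B]
  have hBtop : ∀ X, B X = ⊤ := by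
    refine hA ⟨B, ?_, ?_, ?_⟩ ?_
    · intro X Y f a ha
      rw [hB] at ha ⊢
      intro Z m hm
      have := hNmap (FamVec.disjMap f (𝟙 Z)) _ (ha Z m hm)
      rwa [M.act_natural, map_id_apply] at this
    · rw [hB]
      intro Y m hm
      have := hNmap (emptyDisjInv Y) m hm
      rwa [← M.one_act Y m, ← map_comp_apply, emptyDisjHom_comp_inv, map_id_apply] at this
    · intro X Y a b ha hb
      rw [hB] at ha hb ⊢
      intro Z m hm
      have := hNmap (assocInv X Y Z) _ (ha _ _ (hb Z m hm))
      rwa [← M.mul_act, ← map_comp_apply, assocHom_comp_inv, map_id_apply] at this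
    · rintro s hs
      rw [hB]
      intro Y m hm
      rw [hN] at hm ⊢
      intro k f
      obtain ⟨k', rfl, i, f₁, f₂, rfl⟩ := exists_insert_factor U (hS s hs) f
      rw [map_comp_apply, M.act_natural]
      exact hT s hs f₁ k' i _ (hm k' f₂)
  have hNtop : ∀ X, N X = ⊤ := by
    refine hM ⟨N, hNmap, ?_⟩ fun s hs => (hN _).2 (hT' s hs)
    intro X Y a m hm
    exact (hB a).1 (by rw [hBtop]; trivial) Y m hm
  rw [eq_top_iff]
  intro x _
  induction x using DirectSum.induction_on with
  | zero => exact T.zero_mem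
  | add x y hx hy => exact T.add_mem (hx trivial) (hy trivial)
  | of k m =>
    have hm : m ∈ N (constFam U (Fin k)) := by rw [hNtop]; trivial
    have := (hN m).1 hm k (𝟙 _)
    rwa [map_id_apply] at this

end Insertion

/-! ### Insertion operators and chains on the total space -/

theorem insertMap_insertMap_of_le {A : Alg.{u}} (M : Mod A) (U : ModuleCat.{u} ℂ) {k : ℕ}
    (i j : ℕ) (hi : i < k + 1) (hj : j < k + 1) (hij : i ≤ j)
    (a b : A.F.obj (constFam U Unit)) (h : M.F.obj (constFam U (Fin k))) :
    insertMap M U ⟨i, by omega⟩ a (insertMap M U ⟨j, hj⟩ b h) =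
      insertMap M U ⟨j + 1, by omega⟩ b (insertMap M U ⟨i, hi⟩ a h) :=
  insertMap_insertMap M U ⟨i, hi⟩ ⟨j, hj⟩ hij a b h

/-- The insertion operators on the total space; in positions that do not exist they are zero. -/
noncomputable def totalInsert {A : Alg.{u}} (M : Mod A) (U : ModuleCat.{u} ℂ) {C : Type*}
    (e : C → A.F.obj (constFam U Unit)) (i : ℕ) (c : C) : TotalSpace M U →ₗ[ℂ] TotalSpace M U :=
  DirectSum.toModule ℂ ℕ _ fun k =>
    if h : i < k + 1 then toTotal M U (k + 1) ∘ₗ insertMap M U ⟨i, h⟩ (e c) else 0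

section

variable {A : Alg.{u}} {M : Mod A} {U : ModuleCat.{u} ℂ} {C : Type*}
  {e : C → A.F.obj (constFam U Unit)} {i k : ℕ}

theorem totalInsert_of_lt (hi : i < k + 1) (c : C) (h : M.F.obj (constFam U (Fin k))) :
    totalInsert M U e i c (toTotal M U k h) =
      toTotal M U (k + 1) (insertMap M U ⟨i, hi⟩ (e c) h) := by
  rw [totalInsert, DirectSum.toModule_lof, dif_pos hi]
  rfl

theorem totalInsert_of_not_lt (hi : ¬ i < k + 1) (c : C) (h : M.F.obj (constFam U (Fin k))) :
    totalInsert M U e i c (toTotal M U k h) = 0 := by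
  rw [totalInsert, DirectSum.toModule_lof, dif_neg hi]
  rfl

theorem totalInsert_totalInsert (i j : ℕ) (c c' : C) (h : TotalSpace M U) (hij : i ≤ j) :
    totalInsert M U e i c (totalInsert M U e j c' h) =
      totalInsert M U e (j + 1) c' (totalInsert M U e i c h) := by
  refine LinearMap.congr_fun (f := totalInsert M U e i c ∘ₗ totalInsert M U e j c')
    (g := totalInsert M U e (j + 1) c' ∘ₗ totalInsert M U e i c) ?_ h
  refine DirectSum.linearMap_ext ℂ fun k => LinearMap.ext fun m => ?_
  change totalInsert M U e i c (totalInsert M U e j c' (toTotal M U k m)) =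
    totalInsert M U e (j + 1) c' (totalInsert M U e i c (toTotal M U k m))
  by_cases hj : j < k + 1
  · rw [totalInsert_of_lt hj, totalInsert_of_lt (show i < k + 1 by omega),
      totalInsert_of_lt (show i < k + 1 + 1 by omega),
      totalInsert_of_lt (show j + 1 < k + 1 + 1 by omega),
      insertMap_insertMap_of_le M U i j (by omega) hj hij]
  · rw [totalInsert_of_not_lt hj, map_zero]
    by_cases hi : i < k + 1
    · rw [totalInsert_of_lt hi, totalInsert_of_not_lt (by omega)]
    · rw [totalInsert_of_not_lt hi, map_zero]

end

theorem exists_finite_spanning {W : Type*} [AddCommGroup W] [Module ℂ W] {N : Submodule ℂ W}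
    (hN : FiniteDimensional ℂ N) :
    ∃ (d : ℕ) (e : Fin d → W), Submodule.span ℂ (Set.range e) = N :=
  Submodule.fg_iff_exists_fin_generating_family.1 (Module.Finite.iff_fg.1 hN)

/-- On the families of copies of `U`, every chain of submodules of a finitely generated module
stabilizes. -/
theorem exists_stable_constFam {A : Alg.{u}} (hA : A.FinGenInOrderOne) {M : Mod A}
    (hM : M.FinGen) (U : ModuleCat.{u} ℂ) [FiniteDimensional ℂ U] (N : ℕ → Submod M)
    (hN : ∀ (i : ℕ) (X : FamVec.{u}), (N i).carrier X ≤ (N (i + 1)).carrier X) :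
    ∃ i₀, ∀ i, i₀ ≤ i → ∀ k, (N i).carrier (constFam U (Fin k)) ≤
      (N i₀).carrier (constFam U (Fin k)) := by
  obtain ⟨S, hSfin, hS, hA⟩ := hA
  obtain ⟨S', hS'fin, hM⟩ := hM
  have := hSfin.to_subtype
  have := hS'fin.to_subtype
  have hfA : ∀ s : S, FiniteDimensional ℂ (Submodule.span ℂ (Set.range
      fun f : s.1.1 ⟶ constFam U Unit => (A.F.map f).hom s.1.2)) :=
    fun s => finiteDimensional_span_map A.nice s.1.2 U Unit
  obtain ⟨d, e, he⟩ := exists_finite_spanning (Submodule.finiteDimensional_iSup fun s : S =>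
    Submodule.span ℂ (Set.range fun f : s.1.1 ⟶ constFam U Unit => (A.F.map f).hom s.1.2))
  have hfM : ∀ s : S', ∃ (d : ℕ) (p : Fin d → M.F.obj (constFam U (Fin s.1.1.order))),
      Submodule.span ℂ (Set.range p) = Submodule.span ℂ (Set.range
        fun f : s.1.1 ⟶ constFam U (Fin s.1.1.order) => (M.F.map f).hom s.1.2) :=
    fun s => exists_finite_spanning (finiteDimensional_span_map M.nice s.1.2 U _)
  choose d' p hp using hfM
  let J := Σ s : S', Fin (d' s)
  let n : J → ℕ := fun j => j.1.1.1.order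
  let pJ : J → TotalSpace M U := fun j => toTotal M U (n j) (p j.1 j.2)
  let x : ℕ → Fin d → TotalSpace M U →ₗ[ℂ] TotalSpace M U := totalInsert M U e
  let G : ℕ → Submodule ℂ (TotalSpace M U) := fun k => LinearMap.range (toTotal M U k)
  have hx : ∀ i j c c' h, i ≤ j → x i c (x j c' h) = x (j + 1) c' (x i c h) :=
    fun i j c c' h hij => totalInsert_totalInsert i j c c' h hij
  have hG : ∀ i c k, ∀ h ∈ G k, x i c h ∈ G (k + 1) := by
    rintro i c k _ ⟨h, rfl⟩
    by_cases hi : i < k + 1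
    · exact ⟨_, (totalInsert_of_lt hi c h).symm⟩
    · have h0 : x i c (toTotal M U k h) = 0 := totalInsert_of_not_lt hi c h
      rw [h0]
      exact Submodule.zero_mem _
  have hG' : ∀ i c k, k < i → ∀ h ∈ G k, x i c h = 0 := by
    rintro i c k hk _ ⟨h, rfl⟩
    exact totalInsert_of_not_lt (by omega) c h
  have hpG : ∀ j, pJ j ∈ G (n j) := fun j => ⟨_, rfl⟩
  let T : Submodule ℂ (TotalSpace M U) := Submodule.span ℂ
    {h | ∃ j w, w.count none = n j ∧ h = insertWord x 0 w (pJ j)}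
  have hxT : ∀ (i : ℕ) (c : Fin d), ∀ h ∈ T, x i c h ∈ T := by
    intro i c
    refine Submodule.span_le (p := T.comap (x i c)).2 ?_
    rintro _ ⟨j, w, hw, rfl⟩
    rw [SetLike.mem_coe, Submodule.mem_comap]
    by_cases hi : w.length < i
    · have hmem := insertWord_mem hG w 0 0 (pJ j) (by rw [hw, zero_add]; exact hpG j)
      rw [zero_add] at hmem
      rw [hG' i c _ hi _ hmem]
      exact T.zero_mem
    · obtain ⟨a, b, rfl, ha⟩ : ∃ a b, w = a ++ b ∧ a.length = i :=
        ⟨w.take i, w.drop i, (List.take_append_drop _ _).symm, by simp; omega⟩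
      have hins := insert_insertWord_append hx a b 0 c (pJ j)
      rw [zero_add, ha] at hins
      rw [hins]
      refine Submodule.subset_span ⟨j, _, ?_, rfl⟩
      rw [← hw, List.count_append, List.count_append, List.count_cons_of_ne (by simp)]
  have hT : T = ⊤ := by
    refine eq_top_of_insertMap_mem M U hS hA hM T ?_ ?_
    · intro s hs f k i h hh
      have hspan : (A.F.map f).hom s.2 ∈ Submodule.span ℂ (Set.range e) := by
        rw [he]
        exact Submodule.mem_iSup_of_mem (p := fun s : S => Submodule.span ℂ
          (Set.range fun f : s.1.1 ⟶ constFam U Unit => (A.F.map f).hom s.1.2)) ⟨s, hs⟩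
          (Submodule.subset_span ⟨f, rfl⟩)
      generalize (A.F.map f).hom s.2 = a at hspan
      have hlin : Submodule.span ℂ (Set.range e) ≤ T.comap (toTotal M U (k + 1) ∘ₗ
          (M.F.map (glue U (insertEquiv i))).hom ∘ₗ (M.act _ _).flip h) := by
        refine Submodule.span_le.2 ?_
        rintro _ ⟨c, rfl⟩
        have := hxT i c _ hh
        rwa [show x i c (toTotal M U k h) = _ from totalInsert_of_lt i.2 c h] at this
      exact hlin hspan
    · intro s hs k f
      -- Morphisms are bijective on indices, so a generator reaches only the summand of its own
      -- order.
      obtain rfl : s.1.order = k := (Nat.card_congr f.equiv).trans (Nat.card_fin k)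
      have hspan : (M.F.map f).hom s.2 ∈ Submodule.span ℂ (Set.range (p ⟨s, hs⟩)) := by
        rw [hp]
        exact Submodule.subset_span ⟨f, rfl⟩
      have hlin : Submodule.span ℂ (Set.range (p ⟨s, hs⟩)) ≤ T.comap (toTotal M U _) := by
        refine Submodule.span_le.2 ?_
        rintro _ ⟨l, rfl⟩
        have hword : ∀ m i (h : TotalSpace M U),
            insertWord x i (List.replicate m none) h = h := by
          intro m
          induction m with
          | zero => exact fun i h => rfl
          | succ m ih => exact fun i h => ih (i + 1) h
        -- The word with only `none` inserts nothing and yields the generator itself.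
        exact Submodule.subset_span ⟨⟨⟨s, hs⟩, l⟩, List.replicate s.1.order none,
          List.count_replicate_self, (hword _ _ _).symm⟩
      exact hlin hspan
  -- Placing all `k` in one space yields a stabilization index independent of `k`.
  let NT : ℕ → Submodule ℂ (TotalSpace M U) := fun i =>
    { carrier := {h | ∀ k, h k ∈ (N i).carrier (constFam U (Fin k))}
      zero_mem' := fun k => Submodule.zero_mem _
      add_mem' := fun ha hb k => Submodule.add_mem _ (ha k) (hb k)
      smul_mem' := fun c _ ha k => Submodule.smul_mem _ c (ha k) }
  have hlof : ∀ i k m, m ∈ (N i).carrier (constFam U (Fin k)) ↔ toTotal M U k m ∈ NT i := by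
    intro i k m
    constructor
    · intro hm l
      rcases eq_or_ne k l with rfl | hne
      · rw [DirectSum.lof_apply]
        exact hm
      · rw [show toTotal M U k m l = 0 from DirectSum.of_eq_of_ne _ _ _ hne.symm]
        exact Submodule.zero_mem _
    · intro hm
      have := hm k
      rwa [DirectSum.lof_apply] at this
  have hNT : Monotone NT := monotone_nat_of_le_succ fun i h hh k => hN i _ (hh k)
  have hNTx : ∀ m i c, ∀ h ∈ NT m, x i c h ∈ NT m := by
    intro m i c h hh
    classical
    rw [← DirectSum.sum_support_of h, map_sum]
    refine sum_mem fun k _ => ?_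
    change x i c (toTotal M U k (h k)) ∈ NT m
    by_cases hi : i < k + 1
    · rw [show x i c (toTotal M U k (h k)) = _ from totalInsert_of_lt hi c (h k), ← hlof]
      exact (N m).map_mem _ _ ((N m).act_mem _ _ (hh k))
    · rw [show x i c (toTotal M U k (h k)) = 0 from totalInsert_of_not_lt hi c (h k)]
      exact Submodule.zero_mem _
  obtain ⟨i₀, h₀⟩ := exists_stable_of_insert hx hG hG' pJ n hpG hT NT hNT hNTx
  refine ⟨i₀, fun i hi k m hm => ?_⟩
  rw [hlof] at hm ⊢
  rwa [← h₀ i hi]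

end SymSchur

theorem mainTheorem5 (A : SymSchur.Alg.{u}) (hA : A.FinGenInOrderOne) : A.IsNoetherian := by
  intro M hM N hN
  obtain ⟨D, hD⟩ := hM.exists_degree_bound hA
  obtain ⟨i₀, h⟩ := SymSchur.exists_stable_constFam hA hM (SymSchur.stdSpace D) N hN
  refine ⟨i₀, fun i hi => SymSchur.Submod.ext (funext fun X => le_antisymm ?_ ?_)⟩
  · exact SymSchur.le_of_le_constFam M.nice hD _ _ (N i).map_mem (N i₀).map_mem (h i hi) X
  · exact monotone_nat_of_le_succ (f := fun i => (N i).carrier X) (fun i => hN i X) hi
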